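/- Let $\ell^2(\mathbb N_0)$ be the one-mode Fock space with Fock basis $(|n\rangle)_{n\ge 0}$ and annihilation and creation operators $a|n\rangle=\sqrt n\,|n-1\rangle$, $a^\dagger|n\rangle=\sqrt{n+1}\,|n+1\rangle$. Let $h:\mathbb N_0\to\mathbb R$, $H=h(N)=\sum_n E_n|n\rangle\langle n|$ with $E_n=h(n)$, and $\sigma_\beta=e^{-\beta H}/\operatorname{Tr}(e^{-\beta H})$. For $\beta>0$ let $\widehat f_{\mathscr M}(\nu)=\exp\!\big(-\tfrac14(\sqrt{1+(\beta\nu)^2}+\beta\nu)\big)$. For $A\in\{a,a^\dagger\}$ and $\nu\in B(H)=\{E_m-E_n\}_{m,n}$ put $A_\nu|n\rangle=P_{E_n+\nu}A|n\rangle$, where $P_E$ is the projection onto $\operatorname{span}\{|k\rangle:E_k=E\}$, $A_\nu^\dagger=(A^\dagger)_{-\nu}$, $\delta^A_\nu(x)=e^{-\beta\nu/4}A_\nu x-e^{\beta\nu/4}xA_\nu$ and $(\delta^A_\nu)^\dagger(x)=e^{-\beta\nu/4}A_\nu^\dagger x-e^{\beta\nu/4}xA_\nu^\dagger$. On the Hilbert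 space $\mathscr T_2$ of Hilbert–Schmidt operators on $\ell^2(\mathbb N_0)$ let $L=L_{\widehat f_{\mathscr M},h(N)}$ be the Friedrichs extension of the operator defined for $x\in\operatorname{span}\{|m\rangle\langle n|\}$, $\lambda,\mu\in\mathbb C$ by $$L(\lambda x+\mu\sqrt{\sigma_\beta})=-\lambda\sum_{A\in\{a,a^\dagger\}}\ \sum_{\nu_1,\nu_2\in B(H)}\frac{\overline{\widehat f_{\mathscr M}(\nu_1)}\,\widehat f_{\mathscr M}(\nu_2)\,e^{\beta(\nu_1+\nu_2)/4}}{2\cosh((\nu_1-\nu_2)\beta/4)}\,(\delta^A_{\nu_1})^\dagger\delta^A_{\nu_2}(x).$$ Let $\operatorname{gap}(L)$ be the largest $r$ such that $\operatorname{Re}z\le -r$ for all $z\in\operatorname{Sp}(L)\setminus\{0\}$. **Theorem.** For all $\beta>0$, $n_0\in\mathbb N_0$, $\delta>0$, $s\in\mathbb N$ and $\Delta\in\mathbb R$ there is a constant $\kappa=\kappa(\beta,n_0,\delta,s,\Delta)>0$ with the following property. Let $h:\mathbb N_0\to\mathbb R$ be such that $(E_n)$ is non-decreasing for $n\ge n_0$,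 that $E_{m+s}-E_m\ge\delta$ for all $m\ge n_0$, and that $\Delta_E:=\max_{0\le j,m\le 2n_0}|E_j-E_m|=\Delta$. Then $\operatorname{Tr}(e^{-\beta H})<\infty$, the kernel of $L_{\widehat f_{\mathscr M},h(N)}$ is $\mathbb C\sqrt{\sigma_\beta}$, and $$\operatorname{gap}\big(L_{\widehat f_{\mathscr M},h(N)}\big)\ \ge\ \kappa(\beta,n_0,\delta,s,\Delta_E)\ >\ 0 .$$ -/

import Mathlib

open scoped ComplexConjugate

namespace GibbsSampler

noncomputable section

/-! ### Unbounded operators on a Hilbert space -/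

section Operators

variable {E : Type*} [NormedAddCommGroup E] [InnerProductSpace ℂ E]

/-- The quadratic form `x ↦ -⟪T x, x⟫` of a densely defined operator `T`. -/
def quadForm (T : E →ₗ.[ℂ] E) (x : T.domain) : ℂ := -inner ℂ (T x) (x : E)

/-- The domain of the closure of the form `x ↦ -⟪T x, x⟫`: all limits of sequences in `D(T)` that
are Cauchy for the form. -/
def formDomain (T : E →ₗ.[ℂ] E) : Set E :=
  {x | ∃ u : ℕ → T.domain,
    Filter.Tendsto (fun k => (u k : E)) Filter.atTop (nhds x) ∧
    Filter.Tendsto (fun p : ℕ × ℕ => quadForm T (u p.1 - u p.2)) Filter.atTop (nhds 0)}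

/-- The Friedrichs extension of a densely defined, symmetric, negative semidefinite operator `T`:
the restriction of the adjoint of `T` to the domain of the closed form of `T`.  (For such `T` the
set `formDomain T` is already a linear subspace, so that taking the span does not change it.) -/
def friedrichs [CompleteSpace E] (T : E →ₗ.[ℂ] E) : E →ₗ.[ℂ] E :=
  T.adjoint.domRestrict (Submodule.span ℂ (formDomain T))

/-- `z` is in the resolvent set of `L`: the operator `z - L`, from `D(L)` to `E`, has a bounded
everywhere defined two-sided inverse `R`. -/
def IsResolventPoint (L : E →ₗ.[ℂ] E) (z : ℂ) : Prop :=
  ∃ R : E →L[ℂ] E,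
    (∀ x : L.domain, R (z • (x : E) - L x) = x) ∧
    ∀ y : E, ∃ hy : R y ∈ L.domain, z • R y - L ⟨R y, hy⟩ = y

/-- The spectrum of an unbounded operator. -/
def opSpectrum (L : E →ₗ.[ℂ] E) : Set ℂ := {z | ¬ IsResolventPoint L z}

/-- The spectral gap: the largest `r` with `Re z ≤ -r` for all `z` in the spectrum, `z ≠ 0`. -/
def gap (L : E →ₗ.[ℂ] E) : EReal :=
  sSup ((fun r : ℝ => (r : EReal)) '' {r : ℝ | ∀ z ∈ opSpectrum L, z ≠ 0 → z.re ≤ -r})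

end Operators

/-! ### One bosonic mode -/

/-- Finite linear combinations of the Fock basis vectors `|n⟩`. -/
abbrev FockFin : Type := ℕ →₀ ℂ

/-- Finite linear combinations of the `|m⟩⟨n|`; the entry at `(m, n)` is `⟨m|x|n⟩`. -/
abbrev OpFin : Type := ℕ × ℕ →₀ ℂ

/-- The Hilbert space of Hilbert-Schmidt operators `x` on the one-mode Fock space `ℓ²(ℕ)`, written
through the matrix elements `⟨m|x|n⟩` in the Fock basis.  The inner product is
`Tr (x† y) = ∑ conj ⟨m|x|n⟩ * ⟨m|y|n⟩`. -/
abbrev HilbertSchmidt : Type := lp (fun _ : ℕ × ℕ => ℂ) 2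

/-- The Fock vector `|n⟩`. -/
def ket (n : ℕ) : FockFin := Finsupp.single n 1

/-- The operator `|u⟩⟨v|`. -/
def ketBra (u v : FockFin) : OpFin :=
  u.sum fun m a => v.sum fun n b => Finsupp.single (m, n) (a * conj b)

/-- The annihilation operator, `a |n⟩ = √n |n-1⟩`. -/
def annihilation : FockFin →ₗ[ℂ] FockFin :=
  Finsupp.linearCombination ℂ fun n => ((Real.sqrt n : ℝ) : ℂ) • ket (n - 1)

/-- The creation operator, `a† |n⟩ = √(n+1) |n+1⟩`. -/
def creation : FockFin →ₗ[ℂ] FockFin :=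
  Finsupp.linearCombination ℂ fun n => ((Real.sqrt (n + 1) : ℝ) : ℂ) • ket (n + 1)

/-- The bare jumps `{a, a†}`; the adjoint of `jump b` is `jump (!b)`. -/
def jump : Bool → (FockFin →ₗ[ℂ] FockFin)
  | true => annihilation
  | false => creation

/-- The operator `A_ν`, `A_ν |n⟩ = P_{h(n)+ν} A |n⟩`, where `P_E` is the projection onto the span of
the `|k⟩` with `h(k) = E`, i.e. the spectral projection of `H = h(N)`. -/
def energyPart (h : ℕ → ℝ) (A : FockFin →ₗ[ℂ] FockFin) (ν : ℝ) : FockFin →ₗ[ℂ] FockFin :=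
  Finsupp.linearCombination ℂ fun n =>
    haveI := Classical.decPred fun k : ℕ => h k = h n + ν
    (A (ket n)).filter fun k => h k = h n + ν

/-- `x ↦ A x`. -/
def leftMul (A : FockFin →ₗ[ℂ] FockFin) : OpFin →ₗ[ℂ] OpFin :=
  Finsupp.linearCombination ℂ fun p => ketBra (A (ket p.1)) (ket p.2)

/-- `x ↦ x B†`, that is `|m⟩⟨n| ↦ |m⟩⟨B n|`. -/
def rightMulAdj (B : FockFin →ₗ[ℂ] FockFin) : OpFin →ₗ[ℂ] OpFin :=
  Finsupp.linearCombination ℂ fun p => ketBra (ket p.1) (B (ket p.2))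

/-- The energy component `A_ν` of the jump `b`. -/
def jumpAt (h : ℕ → ℝ) (b : Bool) (ν : ℝ) : FockFin →ₗ[ℂ] FockFin := energyPart h (jump b) ν

/-- The adjoint `(A_ν)† = (A†)_{-ν}`. -/
def jumpAtAdj (h : ℕ → ℝ) (b : Bool) (ν : ℝ) : FockFin →ₗ[ℂ] FockFin :=
  energyPart h (jump (!b)) (-ν)

/-- `δ_ν(x) = e^{-βν/4} A_ν x - e^{βν/4} x A_ν`. -/
def delta (h : ℕ → ℝ) (β : ℝ) (b : Bool) (ν : ℝ) : OpFin →ₗ[ℂ] OpFin :=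
  ((Real.exp (-(β * ν / 4)) : ℝ) : ℂ) • leftMul (jumpAt h b ν)
    - ((Real.exp (β * ν / 4) : ℝ) : ℂ) • rightMulAdj (jumpAtAdj h b ν)

/-- `(δ_ν)†(x) = e^{-βν/4} (A_ν)† x - e^{βν/4} x (A_ν)†`. -/
def deltaAdj (h : ℕ → ℝ) (β : ℝ) (b : Bool) (ν : ℝ) : OpFin →ₗ[ℂ] OpFin :=
  ((Real.exp (-(β * ν / 4)) : ℝ) : ℂ) • leftMul (jumpAtAdj h b ν)
    - ((Real.exp (β * ν / 4) : ℝ) : ℂ) • rightMulAdj (jumpAt h b ν)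

/-- The Bohr frequencies `Sp(H) - Sp(H)` of `H = h(N)`. -/
def bohr (h : ℕ → ℝ) : Set ℝ := {ν | ∃ m n : ℕ, ν = h m - h n}

/-- The coefficient of `(δ_{ν₁})† δ_{ν₂}` for the filter function `f`. -/
def coeff (f : ℝ → ℂ) (β ν₁ ν₂ : ℝ) : ℂ :=
  conj (f ν₁) * f ν₂ * ((Real.exp (β * (ν₁ + ν₂) / 4) : ℝ) : ℂ)
    / ((2 * Real.cosh ((ν₁ - ν₂) * β / 4) : ℝ) : ℂ)

/-- The generator on the span of the `|m⟩⟨n|`: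
`x ↦ -∑_A ∑_{ν₁,ν₂} coeff f β ν₁ ν₂ • (δ_{ν₁})† (δ_{ν₂} x)`, linearly extended from the `|m⟩⟨n|`, on
which only finitely many terms do not vanish. -/
def genFin (f : ℝ → ℂ) (h : ℕ → ℝ) (β : ℝ) : OpFin →ₗ[ℂ] OpFin :=
  Finsupp.linearCombination ℂ fun p =>
    -∑ b : Bool, ∑ᶠ ν ∈ bohr h ×ˢ bohr h,
      coeff f β ν.1 ν.2 • deltaAdj h β b ν.1 (delta h β b ν.2 (Finsupp.single p 1))

/-- The inclusion of the span of the `|m⟩⟨n|` in the Hilbert-Schmidt operators. -/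
def toHS : OpFin →ₗ[ℂ] HilbertSchmidt :=
  Finsupp.linearCombination ℂ fun p => lp.single 2 p (1 : ℂ)

theorem toHS_apply (x : OpFin) (q : ℕ × ℕ) : toHS x q = x q := by
  classical
  induction x using Finsupp.induction_linear with
  | zero => simp
  | add x y hx hy => simp [map_add, hx, hy]
  | single p c =>
    rw [toHS, Finsupp.linearCombination_single, lp.coeFn_smul, Pi.smul_apply, lp.single_apply,
      Finsupp.single_apply]
    by_cases hpq : p = q
    · subst hpq; simp
    · simp [hpq, Ne.symm hpq]

theorem toHS_injective : Function.Injective toHS := fun x y hxy => by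
  ext q
  rw [← toHS_apply x, ← toHS_apply y, hxy]

/-- The partition function `Z(β) = Tr e^{-βH}` of `H = h(N)`. -/
def partitionFn (h : ℕ → ℝ) (β : ℝ) : ℝ := ∑' n, Real.exp (-(β * h n))

/-- Existence of the Gibbs state of `H = h(N)` at inverse temperature `β`: `Tr e^{-βH} < ∞`. -/
def HasGibbsState (h : ℕ → ℝ) (β : ℝ) : Prop := Summable fun n => Real.exp (-(β * h n))

theorem partitionFn_pos {h : ℕ → ℝ} {β : ℝ} (hZ : HasGibbsState h β) : 0 < partitionFn h β :=
  Summable.tsum_pos hZ (fun _ => (Real.exp_pos _).le) 0 (Real.exp_pos _)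

/-- Matrix elements of `√σ_β`, with `σ_β = e^{-βH} / Z(β)`. -/
def sqrtGibbsEntry (h : ℕ → ℝ) (β : ℝ) (p : ℕ × ℕ) : ℂ :=
  if p.1 = p.2 then ((Real.sqrt (Real.exp (-(β * h p.1)) / partitionFn h β) : ℝ) : ℂ) else 0

theorem memℓp_sqrtGibbsEntry {h : ℕ → ℝ} {β : ℝ} (hZ : HasGibbsState h β) :
    Memℓp (sqrtGibbsEntry h β) 2 := by
  apply memℓp_gen
  have hinj : Function.Injective fun n : ℕ => (n, n) := fun a b hab => (Prod.ext_iff.1 hab).1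
  have hz : ∀ p ∉ Set.range fun n : ℕ => (n, n),
      ‖sqrtGibbsEntry h β p‖ ^ (2 : ENNReal).toReal = 0 := by
    rintro ⟨m, n⟩ hp
    have : m ≠ n := fun hmn => hp ⟨m, by simp [hmn]⟩
    simp [sqrtGibbsEntry, this]
  rw [← hinj.summable_iff hz]
  refine (Summable.div_const hZ (partitionFn h β)).congr fun n => ?_
  have h0 : 0 ≤ Real.exp (-(β * h n)) / partitionFn h β :=
    div_nonneg (Real.exp_pos _).le (partitionFn_pos hZ).le
  simp only [Function.comp, sqrtGibbsEntry, if_true, ENNReal.toReal_ofNat, Real.rpow_ofNat,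
    Complex.norm_real, Real.norm_eq_abs, sq_abs, Real.sq_sqrt h0]

/-- `√σ_β` as a Hilbert-Schmidt operator. -/
def sqrtGibbs {h : ℕ → ℝ} {β : ℝ} (hZ : HasGibbsState h β) : HilbertSchmidt :=
  ⟨sqrtGibbsEntry h β, memℓp_sqrtGibbsEntry hZ⟩

theorem sqrtGibbs_notMem {h : ℕ → ℝ} {β : ℝ} (hZ : HasGibbsState h β) :
    sqrtGibbs hZ ∉ LinearMap.range toHS := by
  rintro ⟨x, hx⟩
  obtain ⟨n, hn⟩ := Infinite.exists_notMem_finset (x.support.image Prod.fst)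
  have h0 : x (n, n) = 0 := by
    by_contra hne
    exact hn (Finset.mem_image.2 ⟨(n, n), Finsupp.mem_support_iff.2 hne, rfl⟩)
  have h1 : sqrtGibbsEntry h β (n, n) = 0 := by
    rw [← h0, ← toHS_apply, hx]; rfl
  have h2 : 0 < Real.exp (-(β * h n)) / partitionFn h β :=
    div_pos (Real.exp_pos _) (partitionFn_pos hZ)
  simp [sqrtGibbsEntry, (Real.sqrt_pos.2 h2).ne'] at h1

/-- The generator with domain the span of the `|m⟩⟨n|` inside the Hilbert-Schmidt operators. -/
def genOnF (f : ℝ → ℂ) (h : ℕ → ℝ) (β : ℝ) : HilbertSchmidt →ₗ.[ℂ] HilbertSchmidt where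
  domain := LinearMap.range toHS
  toFun := toHS ∘ₗ genFin f h β ∘ₗ
    (LinearEquiv.ofInjective toHS toHS_injective).symm.toLinearMap

/-- The generator on the span of the `|m⟩⟨n|` and `√σ_β`: it maps `l x + m √σ_β` to `l L(x)`. -/
def genCore (f : ℝ → ℂ) {h : ℕ → ℝ} {β : ℝ} (hZ : HasGibbsState h β) :
    HilbertSchmidt →ₗ.[ℂ] HilbertSchmidt :=
  (genOnF f h β).supSpanSingleton (sqrtGibbs hZ) 0 (sqrtGibbs_notMem hZ)

/-- The Hilbert-Schmidt generator of the Gibbs sampler of `H = h(N)` with jumps `{a, a†}`. -/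
def generator (f : ℝ → ℂ) {h : ℕ → ℝ} {β : ℝ} (hZ : HasGibbsState h β) :
    HilbertSchmidt →ₗ.[ℂ] HilbertSchmidt :=
  friedrichs (genCore f hZ)

/-- The Metropolis-type filter `exp (-(√(1 + (βν)²) + βν) / 4)`. -/
def metropolis (β : ℝ) (ν : ℝ) : ℂ :=
  ((Real.exp (-((Real.sqrt (1 + (β * ν) ^ 2) + β * ν) / 4)) : ℝ) : ℂ)

/-- `Δ_E = max_{0 ≤ j, m ≤ 2 n₀} |E_j - E_m|`. -/
def energySpread (h : ℕ → ℝ) (n₀ : ℕ) : ℝ :=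
  (Finset.range (2 * n₀ + 1) ×ˢ Finset.range (2 * n₀ + 1)).sup' ⟨(0, 0), by simp⟩
    fun p => |h p.1 - h p.2|

end

end GibbsSampler

open scoped ComplexConjugate

namespace GibbsSampler

noncomputable section

/-! The filter times its Boltzmann factor is the even function `filterAmp`, and the weights `1 / (2
cosh)` of the two jumps add up to one on each hop. Hence, in matrix elements, the generator acts
along each diagonal `m - n = const` as a tridiagonal operator with hopping `edgeAmp m * edgeAmp n`
and diagonal entry `-(levelRate m + levelRate n)` (`genFin_single`). Its form is a sum over the
edges from `(m - 1, n - 1)` to `(m, n)` (`re_inner_genFin`).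

With `N = max m n`, an edge term dominates a quarter of the squared increment at the larger index
alone (`edge_lower_bound`). In the variable `V = x / s_N`, where `s_n` is the square root of the
Gibbs weight, that increment is a multiple of `V m n - V (m - 1) (n - 1)`. Off the main diagonal,
`V` starts from zero across an edge. On the main diagonal, subtracting a multiple of `√σ_β` makes `V
0 0` vanish.

The gap inequality is thus a weighted Hardy inequality along the diagonals (`diagonal_hardy`). The
weights are controlled by `gibbsAmp_sq_le`: the energies grow at least linearly up to a bounded
defect, so the Gibbs weights decay geometrically relative to the edge weights. No upper bound on the
level spacing enters, which is why the constant is uniform in `h`.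

An abstract argument (`friedrichs_gap`) passes from the core to the Friedrichs extension: a form
bounded below by `κ` times the squared distance to `ℂ e` gives, by Lax–Milgram on the form space,
the resolvent at every `z ≠ 0` with `Re z > -κ`. -/

/-! ### The Friedrichs extension of an operator with a spectral gap -/

section Friedrichs

open Filter Topology

universe u

variable {E : Type u} [NormedAddCommGroup E] [InnerProductSpace ℂ E]

/-- A Hilbert space `H` which is a completion of the domain of `T` for the inner product
`⟪x, y⟫ - ⟪T x, y⟫`. -/
structure FormModel (T : E →ₗ.[ℂ] E) (H : Type*) [NormedAddCommGroup H]
    [InnerProductSpace ℂ H] where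
  incl : T.domain →ₗ[ℂ] H
  toSpace : H →L[ℂ] E
  dense : DenseRange incl
  toSpace_incl : ∀ x, toSpace (incl x) = x
  inner_incl : ∀ x y, inner ℂ (incl x) (incl y) = inner ℂ (x : E) (y : E) - inner ℂ (T x) (y : E)

/-- The domain of `T`, to be equipped with the form norm. -/
def FormSpace (T : E →ₗ.[ℂ] E) : Type u := T.domain

instance (T : E →ₗ.[ℂ] E) : AddCommGroup (FormSpace T) := inferInstanceAs (AddCommGroup T.domain)

instance (T : E →ₗ.[ℂ] E) : Module ℂ (FormSpace T) := inferInstanceAs (Module ℂ T.domain)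

/-- The inclusion of the form space. -/
def FormSpace.val (T : E →ₗ.[ℂ] E) : FormSpace T →ₗ[ℂ] E := T.domain.subtype

/-- The operator on the form space. -/
def FormSpace.op (T : E →ₗ.[ℂ] E) : FormSpace T →ₗ[ℂ] E := T.toFun

/-- The inner product `⟪x, y⟫ - ⟪T x, y⟫`. -/
@[reducible]
def formCore (T : E →ₗ.[ℂ] E)
    (hsym : ∀ x y : T.domain, inner ℂ (T x) (y : E) = inner ℂ (x : E) (T y))
    (hneg : ∀ x : T.domain, 0 ≤ (quadForm T x).re) : InnerProductSpace.Core ℂ (FormSpace T) where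
  inner x y := inner ℂ (FormSpace.val T x) (FormSpace.val T y)
    - inner ℂ (FormSpace.op T x) (FormSpace.val T y)
  conj_inner_symm x y := by
    rw [map_sub, inner_conj_symm, inner_conj_symm]
    congr 1
    exact (hsym x y).symm
  re_inner_nonneg x := by
    have h1 := hneg x
    have h2 : 0 ≤ RCLike.re (inner ℂ (FormSpace.val T x) (FormSpace.val T x)) := inner_self_nonneg
    have h3 : (quadForm T x).re = -(inner ℂ (FormSpace.op T x) (FormSpace.val T x)).re := Complex.neg_re _
    rw [map_sub]
    change 0 ≤ _ - (inner ℂ (FormSpace.op T x) (FormSpace.val T x)).re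
    linarith
  add_left x y z := by
    simp only [map_add, inner_add_left]; ring
  smul_left x y r := by
    simp only [map_smul, inner_smul_left]; ring
  definite x hx := by
    have h1 := hneg x
    have h3 : (quadForm T x).re = -(inner ℂ (FormSpace.op T x) (FormSpace.val T x)).re := Complex.neg_re _
    have h4 := congrArg Complex.re hx
    rw [Complex.sub_re, Complex.zero_re] at h4
    have h5 : ‖FormSpace.val T x‖ ^ 2 = (inner ℂ (FormSpace.val T x) (FormSpace.val T x)).re :=
      (inner_self_eq_norm_sq (𝕜 := ℂ) _).symm
    have h6 : ‖FormSpace.val T x‖ = 0 := by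
      have : ‖FormSpace.val T x‖ ^ 2 ≤ 0 := by linarith
      nlinarith [norm_nonneg (FormSpace.val T x)]
    exact Subtype.ext (norm_eq_zero.1 h6)

/-- Complete the domain in the form norm. Non-negativity of the form makes the inclusion into `E` a
contraction, so it extends to the completion. -/
theorem exists_formModel [CompleteSpace E] (T : E →ₗ.[ℂ] E)
    (hsym : ∀ x y : T.domain, inner ℂ (T x) (y : E) = inner ℂ (x : E) (T y))
    (hneg : ∀ x : T.domain, 0 ≤ (quadForm T x).re) :
    ∃ (H : Type u) (_ : NormedAddCommGroup H) (_ : InnerProductSpace ℂ H) (_ : CompleteSpace H),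
      Nonempty (FormModel T H) := by
  let c := formCore T hsym hneg
  let i1 : NormedAddCommGroup (FormSpace T) := c.toNormedAddCommGroup
  let i2 : InnerProductSpace ℂ (FormSpace T) := InnerProductSpace.ofCore c.toCore
  have hin : ∀ x y : FormSpace T, inner ℂ x y = inner ℂ (FormSpace.val T x) (FormSpace.val T y)
    - inner ℂ (FormSpace.op T x) (FormSpace.val T y) := fun x y => rfl
  have hb : ∀ x : FormSpace T, ‖FormSpace.val T x‖ ≤ 1 * ‖x‖ := fun x => by
    have h1 := hneg x
    have h3 : (quadForm T x).re = -(inner ℂ (FormSpace.op T x) (FormSpace.val T x)).re := Complex.neg_re _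
    have h4 := congrArg Complex.re (hin x x)
    rw [Complex.sub_re] at h4
    have h5 : ‖FormSpace.val T x‖ ^ 2 = (inner ℂ (FormSpace.val T x) (FormSpace.val T x)).re :=
      (inner_self_eq_norm_sq (𝕜 := ℂ) _).symm
    have h6 : ‖x‖ ^ 2 = (inner ℂ x x).re := (inner_self_eq_norm_sq (𝕜 := ℂ) _).symm
    rw [one_mul]
    exact le_of_sq_le_sq (by linarith) (norm_nonneg _)
  let v : FormSpace T →L[ℂ] E := (FormSpace.val T).mkContinuous 1 hb
  let e : FormSpace T →L[ℂ] UniformSpace.Completion (FormSpace T) :=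
    UniformSpace.Completion.toComplL
  have hext : ∀ x : FormSpace T, v.extend e (e x) = v x :=
    v.extend_eq (e := e) UniformSpace.Completion.denseRange_coe
      (UniformSpace.Completion.isUniformInducing_coe _)
  have hdense : DenseRange e := UniformSpace.Completion.denseRange_coe
  refine ⟨UniformSpace.Completion (FormSpace T), inferInstance, inferInstance, inferInstance, ⟨?_⟩⟩
  refine ⟨e.toLinearMap, v.extend e, hdense, hext,
    fun x y => ?_⟩
  exact (UniformSpace.Completion.inner_coe (𝕜 := ℂ) (E := FormSpace T) x y).trans (hin x y)

/-! ### The closed form and the weak description of the Friedrichs extension -/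

namespace FormModel

variable {T : E →ₗ.[ℂ] E} {H : Type*} [NormedAddCommGroup H] [InnerProductSpace ℂ H]
  (M : FormModel T H)
include M

theorem quadForm_re (x : T.domain) :
    (quadForm T x).re = ‖M.incl x‖ ^ 2 - ‖(x : E)‖ ^ 2 := by
  have h := congrArg Complex.re (M.inner_incl x x)
  rw [Complex.sub_re] at h
  have h1 : ‖(x : E)‖ ^ 2 = (inner ℂ (x : E) (x : E)).re :=
    (inner_self_eq_norm_sq (𝕜 := ℂ) _).symm
  have h2 : ‖M.incl x‖ ^ 2 = (inner ℂ (M.incl x) (M.incl x)).re :=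
    (inner_self_eq_norm_sq (𝕜 := ℂ) _).symm
  rw [quadForm, Complex.neg_re]; linarith

theorem quadForm_eq (x : T.domain) :
    quadForm T x = ((‖M.incl x‖ ^ 2 - ‖(x : E)‖ ^ 2 : ℝ) : ℂ) := by
  have h := M.inner_incl x x
  rw [inner_self_eq_norm_sq_to_K, inner_self_eq_norm_sq_to_K] at h
  rw [quadForm]
  push_cast
  linear_combination -h

/-- The squared norm of `H` is the form plus the squared norm of `E`. So a sequence that converges
in `E` and is Cauchy for the form is Cauchy in `H`, and completeness supplies the preimage. -/
theorem formDomain_eq [CompleteSpace H] : formDomain T = Set.range M.toSpace := by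
  ext x
  constructor
  · rintro ⟨u, hu, hq⟩
    have hc : CauchySeq fun k => M.incl (u k) := by
      rw [cauchySeq_iff_tendsto_dist_atTop_0]
      have h1 : Tendsto (fun p : ℕ × ℕ => dist (u p.1 : E) (u p.2)) atTop (𝓝 0) :=
        cauchySeq_iff_tendsto_dist_atTop_0.1 hu.cauchySeq
      have h2 : Tendsto (fun p : ℕ × ℕ => Real.sqrt ((quadForm T (u p.1 - u p.2)).re
          + dist (u p.1 : E) (u p.2) ^ 2)) atTop (𝓝 0) := by
        have := (((Complex.continuous_re.tendsto 0).comp hq).add (h1.pow 2)).sqrt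
        simpa using this
      refine h2.congr fun p => ?_
      rw [M.quadForm_re, dist_eq_norm, dist_eq_norm, ← map_sub, Submodule.coe_sub, sub_add_cancel,
        Real.sqrt_sq (norm_nonneg _)]
    obtain ⟨g, hg⟩ := cauchySeq_tendsto_of_complete hc
    refine ⟨g, tendsto_nhds_unique ((M.toSpace.continuous.tendsto g).comp hg) ?_⟩
    simpa [Function.comp_def, M.toSpace_incl] using hu
  · rintro ⟨g, rfl⟩
    obtain ⟨w, hw, hwg⟩ := mem_closure_iff_seq_limit.1 (M.dense g)
    choose u hu using hw
    have hu' : (fun k => M.incl (u k)) = w := funext hu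
    rw [← hu'] at hwg
    have h0 : Tendsto (fun k => (u k : E)) atTop (𝓝 (M.toSpace g)) := by
      simpa [Function.comp_def, M.toSpace_incl] using (M.toSpace.continuous.tendsto g).comp hwg
    refine ⟨u, h0, ?_⟩
    have h1 := cauchySeq_iff_tendsto_dist_atTop_0.1 h0.cauchySeq
    have h2 := cauchySeq_iff_tendsto_dist_atTop_0.1 hwg.cauchySeq
    have h3 := (h2.pow 2).sub (h1.pow 2)
    have h4 := (Complex.continuous_ofReal.tendsto _).comp h3
    simp only [ne_eq, OfNat.ofNat_ne_zero, not_false_eq_true, zero_pow, sub_self,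
      Complex.ofReal_zero] at h4
    refine h4.congr fun p => ?_
    rw [M.quadForm_eq, Function.comp, dist_eq_norm, dist_eq_norm, ← map_sub, Submodule.coe_sub]

theorem inner_incl_right
    (hsym : ∀ x y : T.domain, inner ℂ (T x) (y : E) = inner ℂ (x : E) (T y))
    (g : H) (y : T.domain) :
    inner ℂ g (M.incl y) = inner ℂ (M.toSpace g) (y : E) - inner ℂ (M.toSpace g) (T y) := by
  refine M.dense.induction_on (p := fun g => inner ℂ g (M.incl y) =
    inner ℂ (M.toSpace g) (y : E) - inner ℂ (M.toSpace g) (T y)) g ?_ ?_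
  · exact isClosed_eq (by fun_prop) (by fun_prop)
  · intro x
    rw [M.inner_incl, M.toSpace_incl, hsym]

/-- The weak equation on `T.domain` is the adjoint relation, and by density it holds against all of
`H`. All later arguments use only this description; injectivity of `toSpace` is not needed, as some
preimage `g` suffices. -/
theorem mem_friedrichs_iff [CompleteSpace E] [CompleteSpace H] (hd : Dense (T.domain : Set E))
    (hsym : ∀ x y : T.domain, inner ℂ (T x) (y : E) = inner ℂ (x : E) (T y)) (x w : E) :
    (∃ hx : x ∈ (friedrichs T).domain, friedrichs T ⟨x, hx⟩ = w) ↔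
      ∃ g : H, M.toSpace g = x ∧
        ∀ k : H, inner ℂ g k - inner ℂ x (M.toSpace k) = -inner ℂ w (M.toSpace k) := by
  have hspan : Submodule.span ℂ (formDomain T) = LinearMap.range M.toSpace.toLinearMap := by
    rw [M.formDomain_eq]
    exact Submodule.span_eq (LinearMap.range M.toSpace.toLinearMap)
  constructor
  · rintro ⟨⟨hx1, hx2⟩, hw⟩
    rw [hspan] at hx1
    obtain ⟨g, hg⟩ := hx1
    have hg' : M.toSpace g = x := hg
    have hw' : T.adjoint ⟨x, hx2⟩ = w := by
      rw [← hw]; symm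
      exact LinearPMap.domRestrict_apply rfl
    refine ⟨g, hg', fun k => ?_⟩
    refine M.dense.induction_on (p := fun k => inner ℂ g k - inner ℂ x (M.toSpace k) =
      -inner ℂ w (M.toSpace k)) k ?_ ?_
    · exact isClosed_eq (by fun_prop) (by fun_prop)
    · intro y
      have h1 : inner ℂ (T.adjoint ⟨x, hx2⟩) (y : E) = inner ℂ x (T y) :=
        LinearPMap.adjoint_isFormalAdjoint hd ⟨x, hx2⟩ y
      rw [M.inner_incl_right hsym, M.toSpace_incl, hg', ← h1, hw']
      ring
  · rintro ⟨g, hg, hk⟩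
    have h1 : ∀ y : T.domain, inner ℂ w (y : E) = inner ℂ x (T y) := fun y => by
      have := hk (M.incl y)
      rw [M.inner_incl_right hsym, M.toSpace_incl, hg] at this
      linear_combination this
    have h2 : x ∈ T.adjoint.domain := LinearPMap.mem_adjoint_domain_of_exists x ⟨w, h1⟩
    refine ⟨⟨?_, h2⟩, ?_⟩
    · rw [hspan]; exact ⟨g, hg⟩
    · rw [← LinearPMap.adjoint_apply_eq hd ⟨x, h2⟩ h1]
      exact LinearPMap.domRestrict_apply rfl

end FormModel

/-! ### Resolvent, gap and kernel from a coercive form -/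

section Gap

variable [CompleteSpace E] {T : E →ₗ.[ℂ] E} {e : E} {κ : ℝ}

/-- Coercivity of the shifted form outside the half plane to the left of `-κ`. -/
theorem FormModel.exists_resolvent_vector {H : Type*} [NormedAddCommGroup H]
    [InnerProductSpace ℂ H] [CompleteSpace H] (M : FormModel T H) (he1 : ‖e‖ = 1) (hκ : 0 < κ)
    (hgap : ∀ g : H, κ * (‖M.toSpace g‖ ^ 2 - ‖inner ℂ e (M.toSpace g)‖ ^ 2)
      ≤ ‖g‖ ^ 2 - ‖M.toSpace g‖ ^ 2) {z : ℂ} (hz : -κ < z.re) :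
    ∃ S : E →L[ℂ] H, ∀ (y : E) (k : H),
      inner ℂ (S y) k + inner ℂ ((z - 1) • M.toSpace (S y)
        + ((1 - z) * inner ℂ e (M.toSpace (S y))) • e) (M.toSpace k) = inner ℂ y (M.toSpace k) := by
  set J := M.toSpace
  let P : E →L[ℂ] E := (innerSL ℂ e).smulRight e
  have hP : ∀ x, P x = (inner ℂ e x : ℂ) • e := fun x => rfl
  -- `A` represents the form of `z - L + (1 - z) P`, with `P` the projection onto `ℂ e`. The
  -- rank-one term replaces the eigenvalue `z` on `e` by `1`, so coercivity does not fail near `z =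
  -- 0`.
  let A : H →L[ℂ] H := 1 + J.adjoint ∘L ((z - 1) • (1 : E →L[ℂ] E) + (1 - z) • P) ∘L J
  have hA : ∀ g k, inner ℂ (A g) k = inner ℂ g k + inner ℂ ((z - 1) • J g
        + ((1 - z) * inner ℂ e (J g)) • e) (J k) := fun g k => by
    simp [A, ContinuousLinearMap.adjoint_inner_left, hP, smul_smul]
  -- The coercivity constant: on `e` the ratio to the form norm is `1`, and orthogonally to `e` it
  -- is at worst `(κ + Re z) / (1 + κ)`.
  set c : ℝ := min 1 ((κ + z.re) / (1 + κ)) with hc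
  have hc0 : 0 < c := lt_min one_pos (div_pos (by linarith) (by linarith))
  have hc1 : c ≤ 1 := min_le_left _ _
  have hc2 : c * (1 + κ) ≤ κ + z.re := by
    rw [← le_div_iff₀ (by linarith)]; exact min_le_right _ _
  have hunit : IsUnit A := by
    refine A.isUnit_of_forall_le_norm_inner_map (c := ⟨c, hc0.le⟩) hc0 fun g => ?_
    refine le_trans ?_ (Complex.re_le_norm _)
    have h1 : (inner ℂ (A g) g).re = ‖g‖ ^ 2 + (z.re - 1) * (‖J g‖ ^ 2 - ‖inner ℂ e (J g)‖ ^ 2) := by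
      rw [hA, inner_add_left, inner_smul_left, inner_smul_left, inner_self_eq_norm_sq_to_K,
        inner_self_eq_norm_sq_to_K, map_mul, mul_assoc, ← Complex.normSq_eq_conj_mul_self,
        Complex.normSq_eq_norm_sq]
      have e1 : ∀ r : ℝ, ((r : ℂ)) ^ 2 = ((r ^ 2 : ℝ) : ℂ) := fun r => by push_cast; rfl
      simp only [Complex.coe_algebraMap, Complex.add_re, e1, Complex.ofReal_re, Complex.re_mul_ofReal,
        Complex.conj_re, Complex.sub_re, Complex.one_re]
      ring
    have h2 := hgap g
    have h3 : ‖inner ℂ e (J g)‖ ^ 2 ≤ ‖J g‖ ^ 2 := by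
      have := norm_inner_le_norm (𝕜 := ℂ) e (J g)
      rw [he1, one_mul] at this
      gcongr
    rw [h1]
    change ‖g‖ ^ 2 * c ≤ _
    nlinarith [mul_le_mul_of_nonneg_left h2 (sub_nonneg.2 hc1),
      mul_le_mul_of_nonneg_left hc2 (sub_nonneg.2 h3),
      mul_nonneg (sub_nonneg.2 hc1) (sq_nonneg ‖inner ℂ e (J g)‖)]
  obtain ⟨U, hU⟩ := hunit
  refine ⟨(↑U⁻¹ : H →L[ℂ] H) ∘L J.adjoint, fun y k => ?_⟩
  rw [← hA]
  have h : A (((↑U⁻¹ : H →L[ℂ] H) ∘L J.adjoint) y) = J.adjoint y := by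
    rw [← hU]
    exact congrArg (fun B : H →L[ℂ] H => B (J.adjoint y)) U.mul_inv
  rw [h, ContinuousLinearMap.adjoint_inner_left]

/-- A symmetric operator `T` with a normalized zero mode `e`, whose form is at least `κ` times the
squared distance to `ℂ e`: the Friedrichs extension has kernel `ℂ e` and spectral gap `κ`. -/
theorem friedrichs_gap (hd : Dense (T.domain : Set E))
    (hsym : ∀ x y : T.domain, inner ℂ (T x) (y : E) = inner ℂ (x : E) (T y))
    (heD : e ∈ T.domain) (heT : T ⟨e, heD⟩ = 0) (he1 : ‖e‖ = 1) (hκ : 0 < κ)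
    (hgap : ∀ x : T.domain, κ * (‖(x : E)‖ ^ 2 - ‖inner ℂ e (x : E)‖ ^ 2) ≤ (quadForm T x).re) :
    (κ : EReal) ≤ gap (friedrichs T) ∧
      ∀ x : E, (∃ hx : x ∈ (friedrichs T).domain, friedrichs T ⟨x, hx⟩ = 0) ↔
        x ∈ Submodule.span ℂ {e} := by
  have hcs : ∀ x : E, ‖inner ℂ e x‖ ^ 2 ≤ ‖x‖ ^ 2 := fun x => by
    have := norm_inner_le_norm (𝕜 := ℂ) e x
    rw [he1, one_mul] at this
    gcongr
  obtain ⟨H, _, _, _, ⟨M⟩⟩ := exists_formModel T hsym fun x =>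
    (mul_nonneg hκ.le (sub_nonneg.2 (hcs x))).trans (hgap x)
  have hiff := M.mem_friedrichs_iff hd hsym
  have hgapH : ∀ g : H, κ * (‖M.toSpace g‖ ^ 2 - ‖inner ℂ e (M.toSpace g)‖ ^ 2)
      ≤ ‖g‖ ^ 2 - ‖M.toSpace g‖ ^ 2 := fun g => by
    refine M.dense.induction_on (p := fun g => κ * (‖M.toSpace g‖ ^ 2
      - ‖inner ℂ e (M.toSpace g)‖ ^ 2) ≤ ‖g‖ ^ 2 - ‖M.toSpace g‖ ^ 2) g ?_ ?_
    · exact isClosed_le (by fun_prop) (by fun_prop)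
    · intro x
      rw [M.toSpace_incl, ← M.quadForm_re]
      exact hgap x
  have heM : M.toSpace (M.incl ⟨e, heD⟩) = e := M.toSpace_incl _
  have heinner : ∀ g : H, inner ℂ g (M.incl ⟨e, heD⟩) = inner ℂ (M.toSpace g) e := fun g => by
    rw [M.inner_incl_right hsym, heT, inner_zero_right, sub_zero]
  have hee : inner ℂ e e = (1 : ℂ) := by
    rw [inner_self_eq_norm_sq_to_K, he1]; simp
  have heF : ∀ c : ℂ, ∃ hx : c • e ∈ (friedrichs T).domain, friedrichs T ⟨c • e, hx⟩ = 0 := by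
    intro c
    refine (hiff _ _).2 ⟨c • M.incl ⟨e, heD⟩, by rw [map_smul, heM], fun k => ?_⟩
    rw [inner_smul_left, ← inner_conj_symm, heinner, inner_conj_symm, inner_smul_left]
    simp
  refine ⟨?_, fun x => ⟨fun hx => ?_, fun hx => ?_⟩⟩
  · refine le_sSup ⟨κ, fun z hz hz0 => ?_, rfl⟩
    by_contra! hzκ
    refine hz ?_
    obtain ⟨S, hS⟩ := M.exists_resolvent_vector he1 hκ hgapH hzκ
    -- Testing the eigenvalue equation against `e` gives `⟪x, e⟫ = 0` since `z ≠ 0`; testing it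
    -- against `x` then contradicts the gap inequality unless `x = 0`.
    have huniq : ∀ x : (friedrichs T).domain, z • (x : E) - friedrichs T x = 0 → (x : E) = 0 := by
      rintro ⟨x, hx⟩ h0
      obtain ⟨g, hg, hk⟩ := (hiff x (z • x)).1 ⟨hx, (sub_eq_zero.1 h0).symm⟩
      have h1 := hk (M.incl ⟨e, heD⟩)
      rw [heinner, heM, hg, sub_self, inner_smul_left, zero_eq_neg, mul_eq_zero] at h1
      have h2 : inner ℂ e x = (0 : ℂ) := by
        rw [← inner_conj_symm, h1.resolve_left (by simpa using hz0), map_zero]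
      have h3 := congrArg Complex.re (hk g)
      rw [hg, inner_smul_left, inner_self_eq_norm_sq_to_K, inner_self_eq_norm_sq_to_K] at h3
      have e1 : ∀ r : ℝ, ((r : ℂ)) ^ 2 = ((r ^ 2 : ℝ) : ℂ) := fun r => by push_cast; rfl
      simp only [Complex.coe_algebraMap, Complex.sub_re, Complex.neg_re, e1, Complex.ofReal_re,
        Complex.re_mul_ofReal, Complex.conj_re] at h3
      have h4 := hgapH g
      rw [hg, h2, norm_zero] at h4
      have h5 : ‖x‖ ^ 2 ≤ 0 := by
        by_contra! h
        nlinarith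
      exact norm_eq_zero.1 (by nlinarith [norm_nonneg x])
    -- The modified problem acts as the identity along `e`; the correction turns this component into
    -- `z⁻¹ ⟪e, y⟫`.
    let R : E →L[ℂ] E := M.toSpace ∘L S + (z⁻¹ - 1) • (innerSL ℂ e).smulRight e
    have hR : ∀ y, R y = M.toSpace (S y) + ((z⁻¹ - 1) * inner ℂ e y) • e := fun y => by
      simp [R, smul_smul]
    have hsolve : ∀ y, ∃ hy : R y ∈ (friedrichs T).domain, z • R y - friedrichs T ⟨R y, hy⟩ = y := by
      intro y
      set x := M.toSpace (S y) with hx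
      have h1 : ∃ hx : x ∈ (friedrichs T).domain, friedrichs T ⟨x, hx⟩ =
          z • x + ((1 - z) * inner ℂ e x) • e - y := by
        refine (hiff _ _).2 ⟨S y, rfl, fun k => ?_⟩
        have h2 := hS y k
        rw [← hx] at h2
        simp only [inner_add_left, inner_sub_left, inner_smul_left, map_sub, map_one, map_mul]
          at h2 ⊢
        linear_combination h2
      have h3 : inner ℂ x e = inner ℂ y e := by
        have h2 := hS y (M.incl ⟨e, heD⟩)
        rw [← hx, heinner, heM, ← hx] at h2
        simp only [inner_add_left, inner_smul_left, map_sub, map_one, map_mul, hee,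
          inner_conj_symm] at h2
        linear_combination h2
      have h3' : inner ℂ e x = inner ℂ e y := by
        rw [← inner_conj_symm, h3, inner_conj_symm]
      obtain ⟨hxm, hxv⟩ := h1
      obtain ⟨hem, hev⟩ := heF ((z⁻¹ - 1) * inner ℂ e y)
      have hmem : R y ∈ (friedrichs T).domain := by
        rw [hR]; exact add_mem hxm hem
      refine ⟨hmem, ?_⟩
      have h4 : (⟨R y, hmem⟩ : (friedrichs T).domain) = ⟨x, hxm⟩ + ⟨_, hem⟩ := Subtype.ext (hR y)
      rw [h4, LinearPMap.map_add, hxv, hev, hR, ← hx, h3']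
      have h5 : z * ((z⁻¹ - 1) * inner ℂ e y) = (1 - z) * inner ℂ e y := by
        field_simp
      rw [smul_add, smul_smul, h5]
      abel
    refine ⟨R, fun x => ?_, hsolve⟩
    obtain ⟨hm, hv⟩ := hsolve (z • (x : E) - friedrichs T x)
    refine sub_eq_zero.1 (huniq (⟨_, hm⟩ - x) ?_)
    rw [LinearPMap.map_sub, Submodule.coe_sub, smul_sub, sub_sub_sub_comm, hv, sub_self]
  · obtain ⟨g, hg, hk⟩ := (hiff x 0).1 hx
    have h3 := congrArg Complex.re (hk g)
    rw [hg, inner_zero_left, inner_self_eq_norm_sq_to_K, inner_self_eq_norm_sq_to_K] at h3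
    have e1 : ∀ r : ℝ, ((r : ℂ)) ^ 2 = ((r ^ 2 : ℝ) : ℂ) := fun r => by push_cast; rfl
    simp only [Complex.coe_algebraMap, Complex.sub_re, e1, Complex.ofReal_re,
      Complex.zero_re, neg_zero] at h3
    have h4 := hgapH g
    rw [hg, h3] at h4
    have h5 : ‖x - (inner ℂ e x : ℂ) • e‖ ^ 2 = ‖x‖ ^ 2 - ‖inner ℂ e x‖ ^ 2 := by
      have h6 := norm_sub_sq (𝕜 := ℂ) x ((inner ℂ e x : ℂ) • e)
      rw [inner_smul_right, ← inner_conj_symm x e, norm_smul, he1, mul_one, Complex.mul_conj,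
        Complex.normSq_eq_norm_sq] at h6
      rw [h6]
      simp only [RCLike.re_to_complex, Complex.ofReal_re]
      ring
    have h7 : ‖x - (inner ℂ e x : ℂ) • e‖ ^ 2 ≤ 0 := by
      rw [h5]
      by_contra! h
      nlinarith
    have h8 : x - (inner ℂ e x : ℂ) • e = 0 :=
      norm_eq_zero.1 (by nlinarith [norm_nonneg (x - (inner ℂ e x : ℂ) • e)])
    exact Submodule.mem_span_singleton.2 ⟨_, (sub_eq_zero.1 h8).symm⟩
  · obtain ⟨c, rfl⟩ := Submodule.mem_span_singleton.1 hx
    exact heF c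

end Gap

end Friedrichs

/-! ### Matrix elements of the generator -/

section Matrix

variable (h : ℕ → ℝ) (β : ℝ)

/-- The level reached from `|n⟩` by the jump `b`. -/
def jumpTarget (b : Bool) (n : ℕ) : ℕ := if b then n - 1 else n + 1

/-- The amplitude of the jump `b` out of `|n⟩`. -/
def jumpAmp (b : Bool) (n : ℕ) : ℝ := if b then Real.sqrt n else Real.sqrt (n + 1)

/-- The energy gained by the jump `b` out of `|n⟩`. -/
def jumpFreq (b : Bool) (n : ℕ) : ℝ := h (jumpTarget b n) - h n

theorem jump_ket (b : Bool) (n : ℕ) :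
    jump b (ket n) = (jumpAmp b n : ℂ) • ket (jumpTarget b n) := by
  cases b <;>
    simp [jump, annihilation, creation, ket, jumpAmp, jumpTarget,
      Finsupp.linearCombination_single]

theorem jumpAt_ket (b : Bool) (ν : ℝ) (n : ℕ) :
    jumpAt h b ν (ket n) =
      if ν = jumpFreq h b n then (jumpAmp b n : ℂ) • ket (jumpTarget b n) else 0 := by
  have h1 : jumpAt h b ν (ket n) = (haveI := Classical.decPred fun k : ℕ => h k = h n + ν
      (jump b (ket n)).filter fun k => h k = h n + ν) := by
    rw [jumpAt, energyPart, ket, Finsupp.linearCombination_single, one_smul]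
    rfl
  rw [h1, jump_ket, ket, Finsupp.smul_single]
  split_ifs with hν
  · rw [Finsupp.filter_single_of_pos]
    rw [hν, jumpFreq]; ring
  · rw [Finsupp.filter_single_of_neg]
    intro h2
    refine hν ?_
    rw [jumpFreq, h2]; ring

theorem ketBra_single (m n : ℕ) (a b : ℂ) :
    ketBra (Finsupp.single m a) (Finsupp.single n b) = Finsupp.single (m, n) (a * conj b) := by
  rw [ketBra, Finsupp.sum_single_index, Finsupp.sum_single_index] <;> simp

theorem leftMul_jumpAt_single (b : Bool) (ν : ℝ) (m n : ℕ) (c : ℂ) :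
    leftMul (jumpAt h b ν) (Finsupp.single (m, n) c) =
      if ν = jumpFreq h b m then Finsupp.single (jumpTarget b m, n) (c * jumpAmp b m) else 0 := by
  rw [leftMul, Finsupp.linearCombination_single, jumpAt_ket]
  split_ifs with hν
  · rw [ket, ket, Finsupp.smul_single, ketBra_single, Finsupp.smul_single]
    simp
  · simp [ketBra]

theorem rightMulAdj_jumpAt_single (b : Bool) (ν : ℝ) (m n : ℕ) (c : ℂ) :
    rightMulAdj (jumpAt h b ν) (Finsupp.single (m, n) c) =
      if ν = jumpFreq h b n then Finsupp.single (m, jumpTarget b n) (c * jumpAmp b n) else 0 := by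
  rw [rightMulAdj, Finsupp.linearCombination_single, jumpAt_ket]
  split_ifs with hν
  · rw [ket, ket, Finsupp.smul_single, ketBra_single, Finsupp.smul_single]
    simp
  · simp [ketBra]

theorem delta_single (b : Bool) (ν : ℝ) (m n : ℕ) (c : ℂ) :
    delta h β b ν (Finsupp.single (m, n) c) =
      (if ν = jumpFreq h b m then Finsupp.single (jumpTarget b m, n)
        (c * ((Real.exp (-(β * ν / 4)) * jumpAmp b m : ℝ) : ℂ)) else 0)
      - if -ν = jumpFreq h (!b) n then Finsupp.single (m, jumpTarget (!b) n)
        (c * ((Real.exp (β * ν / 4) * jumpAmp (!b) n : ℝ) : ℂ)) else 0 := by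
  rw [delta, LinearMap.sub_apply, LinearMap.smul_apply, LinearMap.smul_apply,
    leftMul_jumpAt_single]
  rw [show jumpAtAdj h b ν = jumpAt h (!b) (-ν) from rfl, rightMulAdj_jumpAt_single]
  congr 1
  · split_ifs
    · rw [Finsupp.smul_single, smul_eq_mul]; push_cast; congr 1; ring
    · rw [smul_zero]
  · split_ifs
    · rw [Finsupp.smul_single, smul_eq_mul]; push_cast; congr 1; ring
    · rw [smul_zero]

theorem deltaAdj_single (b : Bool) (ν : ℝ) (m n : ℕ) (c : ℂ) :
    deltaAdj h β b ν (Finsupp.single (m, n) c) =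
      (if -ν = jumpFreq h (!b) m then Finsupp.single (jumpTarget (!b) m, n)
        (c * ((Real.exp (-(β * ν / 4)) * jumpAmp (!b) m : ℝ) : ℂ)) else 0)
      - if ν = jumpFreq h b n then Finsupp.single (m, jumpTarget b n)
        (c * ((Real.exp (β * ν / 4) * jumpAmp b n : ℝ) : ℂ)) else 0 := by
  rw [deltaAdj, LinearMap.sub_apply, LinearMap.smul_apply, LinearMap.smul_apply,
    rightMulAdj_jumpAt_single]
  rw [show jumpAtAdj h b ν = jumpAt h (!b) (-ν) from rfl, leftMul_jumpAt_single]
  congr 1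
  · split_ifs
    · rw [Finsupp.smul_single, smul_eq_mul]; push_cast; congr 1; ring
    · rw [smul_zero]
  · split_ifs
    · rw [Finsupp.smul_single, smul_eq_mul]; push_cast; congr 1; ring
    · rw [smul_zero]

-- `δ†δ` of a matrix unit has four contributions, each at a single pair of frequencies. The four
-- pairs may coincide, so the indicators are summed separately over a common finite set.
open Classical in
theorem finsum_mem_ite_four {ι M : Type*} [AddCommGroup M] {S : Set ι} {w₁ w₂ w₃ w₄ : ι}
    (h₁ : w₁ ∈ S) (h₂ : w₂ ∈ S) (h₃ : w₃ ∈ S) (h₄ : w₄ ∈ S) (v₁ v₂ v₃ v₄ : M) {G : ι → M}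
    (hG : ∀ ν, G ν = (if ν = w₁ then v₁ else 0) - (if ν = w₂ then v₂ else 0)
      - ((if ν = w₃ then v₃ else 0) - if ν = w₄ then v₄ else 0)) :
    ∑ᶠ ν ∈ S, G ν = v₁ - v₂ - (v₃ - v₄) := by
  have hs : S ∩ Function.support G = ↑({w₁, w₂, w₃, w₄} : Finset ι) ∩ Function.support G := by
    ext ν
    simp only [Set.mem_inter_iff, Function.mem_support, Finset.coe_insert, Finset.coe_singleton,
      Set.mem_insert_iff, Set.mem_singleton_iff, and_congr_left_iff]
    intro hν
    constructor
    · intro _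
      by_contra! hne
      exact hν (by simp [hG, hne.1, hne.2.1, hne.2.2.1, hne.2.2.2])
    · rintro (rfl | rfl | rfl | rfl) <;> assumption
  rw [finsum_mem_eq_sum_of_inter_support_eq _ hs]
  simp only [hG, Finset.sum_sub_distrib, Finset.sum_ite_eq', Finset.mem_insert,
    Finset.mem_singleton, true_or, or_true, if_true]

/-- The filter times the Boltzmann factor. -/
def filterAmp (ν : ℝ) : ℝ := Real.exp (-(Real.sqrt (1 + (β * ν) ^ 2) / 4))

theorem filterAmp_neg (ν : ℝ) : filterAmp β (-ν) = filterAmp β ν := by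
  simp [filterAmp]

/-- The Boltzmann factor cancels the odd part of the exponent of the filter. The even remainder
gives both directions across an edge the same amplitude. -/
theorem coeff_metropolis (ν₁ ν₂ : ℝ) : coeff (metropolis β) β ν₁ ν₂ =
    ((filterAmp β ν₁ * filterAmp β ν₂ / (2 * Real.cosh (β * (ν₁ - ν₂) / 4)) : ℝ) : ℂ) := by
  rw [coeff, metropolis, metropolis, Complex.conj_ofReal, ← Complex.ofReal_mul,
    ← Complex.ofReal_mul, ← Complex.ofReal_div, filterAmp, filterAmp, ← Real.exp_add,
    ← Real.exp_add, ← Real.exp_add]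
  congr 2
  · congr 1; ring
  · congr 2; ring

theorem jumpFreq_mem_bohr (b : Bool) (n : ℕ) : jumpFreq h b n ∈ bohr h := ⟨_, _, rfl⟩

theorem neg_jumpFreq_mem_bohr (b : Bool) (n : ℕ) : -jumpFreq h b n ∈ bohr h :=
  ⟨_, _, neg_sub _ _⟩

/-- A non-zero amplitude excludes annihilation at level `0`, where `n - 1` is truncated and the jump
cannot be reversed. -/
theorem jump_back (b : Bool) (n : ℕ) (hb : jumpAmp b n ≠ 0) :
    jumpTarget (!b) (jumpTarget b n) = n ∧ jumpAmp (!b) (jumpTarget b n) = jumpAmp b n ∧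
      jumpFreq h (!b) (jumpTarget b n) = -jumpFreq h b n := by
  have h1 : jumpTarget (!b) (jumpTarget b n) = n := by
    cases b
    · simp [jumpTarget]
    · have : n ≠ 0 := by rintro rfl; simp [jumpAmp] at hb
      simp only [jumpTarget, Bool.not_true, if_true]
      simp; omega
  refine ⟨h1, ?_, ?_⟩
  · cases b
    · simp [jumpAmp, jumpTarget]
    · have : 1 ≤ n := by
        by_contra! h0
        obtain rfl : n = 0 := by omega
        simp [jumpAmp] at hb
      simp [jumpAmp, jumpTarget, Nat.cast_sub this]
  · rw [jumpFreq, h1, jumpFreq, neg_sub]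

/-- The diagonal coefficient contributed by the jump `b` at level `n`. -/
def diagAmp (b : Bool) (n : ℕ) : ℝ :=
  (filterAmp β (jumpFreq h b n) * jumpAmp b n) ^ 2 * Real.exp (-(β * jumpFreq h b n / 2)) / 2

/-- The amplitude for hopping along a diagonal. -/
def hopAmp (b : Bool) (n : ℕ) : ℝ := filterAmp β (jumpFreq h b n) * jumpAmp b n

/-- The jumps `a` and `a†` both contribute to the same hop, with these two weights; their sum
removes the `cosh` from the generator. -/
theorem exp_div_cosh (x : ℝ) :
    Real.exp x / (2 * Real.cosh x) + Real.exp (-x) / (2 * Real.cosh x) = 1 := by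
  rw [← add_div, Real.cosh_eq, mul_div_cancel₀ _ (two_ne_zero), div_self]
  positivity

theorem finsum_jump (b : Bool) (m n : ℕ) :
    (∑ᶠ ν ∈ bohr h ×ˢ bohr h, coeff (metropolis β) β ν.1 ν.2 •
      deltaAdj h β b ν.1 (delta h β b ν.2 (Finsupp.single (m, n) 1))) =
    Finsupp.single (m, n) (diagAmp h β b m : ℂ)
    - Finsupp.single (jumpTarget b m, jumpTarget b n)
      ((hopAmp h β b m * hopAmp h β b n *
        (Real.exp (β * (jumpFreq h b n - jumpFreq h b m) / 4)
          / (2 * Real.cosh (β * (jumpFreq h b n - jumpFreq h b m) / 4))) : ℝ) : ℂ)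
    - (Finsupp.single (jumpTarget (!b) m, jumpTarget (!b) n)
      ((hopAmp h β (!b) m * hopAmp h β (!b) n *
        (Real.exp (-(β * (jumpFreq h (!b) n - jumpFreq h (!b) m) / 4))
          / (2 * Real.cosh (β * (jumpFreq h (!b) n - jumpFreq h (!b) m) / 4))) : ℝ) : ℂ)
      - Finsupp.single (m, n) (diagAmp h β (!b) n : ℂ)) := by
  classical
  -- The order is left-left, right-left, left-right, right-right. In the first and last pair the
  -- return frequency is left unsimplified: it equals the outgoing one only when the amplitude does
  -- not vanish (`jump_back`).
  refine finsum_mem_ite_four (w₁ := (-jumpFreq h (!b) (jumpTarget b m), jumpFreq h b m))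
    (w₂ := (jumpFreq h b n, jumpFreq h b m))
    (w₃ := (-jumpFreq h (!b) m, -jumpFreq h (!b) n))
    (w₄ := (jumpFreq h b (jumpTarget (!b) n), -jumpFreq h (!b) n))
    (Set.mk_mem_prod (neg_jumpFreq_mem_bohr h _ _) (jumpFreq_mem_bohr h _ _))
    (Set.mk_mem_prod (jumpFreq_mem_bohr h _ _) (jumpFreq_mem_bohr h _ _))
    (Set.mk_mem_prod (neg_jumpFreq_mem_bohr h _ _) (neg_jumpFreq_mem_bohr h _ _))
    (Set.mk_mem_prod (jumpFreq_mem_bohr h _ _) (neg_jumpFreq_mem_bohr h _ _)) _ _ _ _ ?_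
  rintro ⟨ν₁, ν₂⟩
  dsimp only
  rw [delta_single, map_sub, smul_sub, coeff_metropolis]
  congr 1
  · rw [apply_ite (deltaAdj h β b ν₁), map_zero, deltaAdj_single, smul_ite, smul_zero, smul_sub,
      smul_ite, smul_zero, smul_ite, smul_zero, Finsupp.smul_single, Finsupp.smul_single]
    by_cases h2 : ν₂ = jumpFreq h b m
    · rw [if_pos h2]
      congr 1
      · by_cases h1 : -ν₁ = jumpFreq h (!b) (jumpTarget b m)
        · rw [if_pos h1, if_pos (Prod.ext (by rw [← h1, neg_neg]) h2)]
          by_cases h0 : jumpAmp b m = 0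
          · simp [h0, diagAmp]
          · obtain ⟨j1, j2, j3⟩ := jump_back h b m h0
            have h1' : ν₁ = jumpFreq h b m := by rw [← neg_neg ν₁, h1, j3, neg_neg]
            rw [j1, j2, h1', h2, smul_eq_mul, one_mul, ← Complex.ofReal_mul, ← Complex.ofReal_mul,
              sub_self, mul_zero, zero_div, Real.cosh_zero, diagAmp]
            congr 2
            rw [show -(β * jumpFreq h b m / 2) = -(β * jumpFreq h b m / 4)
              + -(β * jumpFreq h b m / 4) by ring, Real.exp_add]
            ring
        · rw [if_neg h1, if_neg]
          intro h3
          exact h1 (by rw [(Prod.mk.inj h3).1, neg_neg])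
      · by_cases h1 : ν₁ = jumpFreq h b n
        · rw [if_pos h1, if_pos (Prod.ext h1 h2), h1, h2, smul_eq_mul, one_mul,
            ← Complex.ofReal_mul, ← Complex.ofReal_mul, hopAmp, hopAmp]
          congr 2
          rw [show β * (jumpFreq h b n - jumpFreq h b m) / 4 = -(β * jumpFreq h b m / 4)
            + β * jumpFreq h b n / 4 by ring, Real.exp_add]
          ring
        · rw [if_neg h1, if_neg]
          intro h3
          exact h1 (Prod.mk.inj h3).1
    · rw [if_neg h2, if_neg, if_neg, sub_self]
      · intro h3; exact h2 (Prod.mk.inj h3).2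
      · intro h3; exact h2 (Prod.mk.inj h3).2
  · rw [apply_ite (deltaAdj h β b ν₁), map_zero, deltaAdj_single, smul_ite, smul_zero, smul_sub,
      smul_ite, smul_zero, smul_ite, smul_zero, Finsupp.smul_single, Finsupp.smul_single]
    by_cases h2 : -ν₂ = jumpFreq h (!b) n
    · have h2' : ν₂ = -jumpFreq h (!b) n := by rw [← h2, neg_neg]
      rw [if_pos h2]
      congr 1
      · by_cases h1 : -ν₁ = jumpFreq h (!b) m
        · have h1' : ν₁ = -jumpFreq h (!b) m := by rw [← h1, neg_neg]
          rw [if_pos h1, if_pos (Prod.ext h1' h2'), h1', h2', smul_eq_mul, one_mul,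
            ← Complex.ofReal_mul, ← Complex.ofReal_mul, hopAmp, hopAmp, filterAmp_neg,
            filterAmp_neg]
          congr 2
          rw [show -(β * (jumpFreq h (!b) n - jumpFreq h (!b) m) / 4)
            = -(β * -jumpFreq h (!b) m / 4) + β * -jumpFreq h (!b) n / 4 by ring, Real.exp_add,
            show β * (-jumpFreq h (!b) m - -jumpFreq h (!b) n) / 4
              = β * (jumpFreq h (!b) n - jumpFreq h (!b) m) / 4 by ring]
          ring
        · rw [if_neg h1, if_neg]
          intro h3
          exact h1 (by rw [(Prod.mk.inj h3).1, neg_neg])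
      · by_cases h1 : ν₁ = jumpFreq h b (jumpTarget (!b) n)
        · rw [if_pos h1, if_pos (Prod.ext h1 h2')]
          by_cases h0 : jumpAmp (!b) n = 0
          · simp [h0, diagAmp]
          · obtain ⟨j1, j2, j3⟩ := jump_back h (!b) n h0
            rw [Bool.not_not] at j1 j2 j3
            have h1' : ν₁ = -jumpFreq h (!b) n := by rw [h1, j3]
            rw [j1, j2, h1', h2', smul_eq_mul, one_mul, ← Complex.ofReal_mul,
              ← Complex.ofReal_mul, sub_self, mul_zero, zero_div, Real.cosh_zero, diagAmp,
              filterAmp_neg]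
            congr 2
            rw [show -(β * jumpFreq h (!b) n / 2) = β * -jumpFreq h (!b) n / 4
              + β * -jumpFreq h (!b) n / 4 by ring, Real.exp_add]
            ring
        · rw [if_neg h1, if_neg]
          intro h3
          exact h1 (Prod.mk.inj h3).1
    · rw [if_neg h2, if_neg, if_neg, sub_self]
      · intro h3; exact h2 (by rw [(Prod.mk.inj h3).2, neg_neg])
      · intro h3; exact h2 (by rw [(Prod.mk.inj h3).2, neg_neg])

/-- The amplitude of the edge between the levels `n - 1` and `n`; it vanishes for `n = 0`. -/
def edgeAmp (n : ℕ) : ℝ := filterAmp β (h n - h (n - 1)) * Real.sqrt n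

/-- Rate of the jump from `n` down to `n - 1`. -/
def downRate (n : ℕ) : ℝ := edgeAmp h β n ^ 2 * Real.exp (β * (h n - h (n - 1)) / 2)

/-- Rate of the jump from `n - 1` up to `n`. -/
def upRate (n : ℕ) : ℝ := edgeAmp h β n ^ 2 * Real.exp (-(β * (h n - h (n - 1)) / 2))

/-- Diagonal coefficient of the generator. -/
def levelRate (n : ℕ) : ℝ := (downRate h β n + upRate h β (n + 1)) / 2

theorem genFin_single (m n : ℕ) :
    genFin (metropolis β) h β (Finsupp.single (m, n) 1) =
      Finsupp.single (m - 1, n - 1) ((edgeAmp h β m * edgeAmp h β n : ℝ) : ℂ)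
      + Finsupp.single (m + 1, n + 1) ((edgeAmp h β (m + 1) * edgeAmp h β (n + 1) : ℝ) : ℂ)
      - Finsupp.single (m, n) ((levelRate h β m + levelRate h β n : ℝ) : ℂ) := by
  have hd : ∀ k, diagAmp h β true k + diagAmp h β false k = levelRate h β k := fun k => by
    simp only [diagAmp, levelRate, downRate, upRate, edgeAmp, jumpFreq, jumpTarget, jumpAmp,
      if_true, Bool.false_eq_true, if_false, Nat.add_sub_cancel, Nat.cast_add, Nat.cast_one]
    rw [← filterAmp_neg, neg_sub,
      show -(β * (h (k - 1) - h k) / 2) = β * (h k - h (k - 1)) / 2 by ring]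
    ring
  have ht : ∀ k, hopAmp h β true k = edgeAmp h β k := fun k => by
    simp only [hopAmp, edgeAmp, jumpFreq, jumpTarget, jumpAmp, if_true]
    rw [← filterAmp_neg, neg_sub]
  have hf : ∀ k, hopAmp h β false k = edgeAmp h β (k + 1) := fun k => by
    simp [hopAmp, edgeAmp, jumpFreq, jumpTarget, jumpAmp]
  have hx : ∀ (p : ℕ × ℕ) (r x : ℝ), Finsupp.single p ((r : ℝ) : ℂ) =
      Finsupp.single p ((r * (Real.exp x / (2 * Real.cosh x)) : ℝ) : ℂ)
      + Finsupp.single p ((r * (Real.exp (-x) / (2 * Real.cosh x)) : ℝ) : ℂ) := fun p r x => by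
    rw [← Finsupp.single_add, ← Complex.ofReal_add, ← mul_add, exp_div_cosh, mul_one]
  rw [genFin, Finsupp.linearCombination_single, one_smul, Fintype.sum_bool, finsum_jump,
    finsum_jump]
  simp only [Bool.not_true, Bool.not_false]
  rw [← hd, ← hd, ← ht, ← ht, ← hf, ← hf,
    hx (m - 1, n - 1) _ (β * (jumpFreq h true n - jumpFreq h true m) / 4),
    hx (m + 1, n + 1) _ (β * (jumpFreq h false n - jumpFreq h false m) / 4)]
  simp only [Complex.ofReal_add, Finsupp.single_add]
  simp only [show ∀ k, jumpTarget true k = k - 1 from fun k => rfl,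
    show ∀ k, jumpTarget false k = k + 1 from fun k => rfl]
  abel

end Matrix

/-! ### The form of the generator -/

section Form

variable (h : ℕ → ℝ) (β : ℝ)

theorem edgeAmp_zero : edgeAmp h β 0 = 0 := by simp [edgeAmp]

theorem edgeAmp_nonneg (n : ℕ) : 0 ≤ edgeAmp h β n :=
  mul_nonneg (Real.exp_pos _).le (Real.sqrt_nonneg _)

/-- Truncation in `m - 1` and `n - 1` is harmless, as the amplitude in front vanishes at level `0`.
-/
theorem genFin_apply (x : OpFin) (m n : ℕ) :
    genFin (metropolis β) h β x (m, n) =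
      ((edgeAmp h β (m + 1) * edgeAmp h β (n + 1) : ℝ) : ℂ) * x (m + 1, n + 1)
      + ((edgeAmp h β m * edgeAmp h β n : ℝ) : ℂ) * x (m - 1, n - 1)
      - ((levelRate h β m + levelRate h β n : ℝ) : ℂ) * x (m, n) := by
  classical
  induction x using Finsupp.induction_linear with
  | zero => simp
  | add x y hx hy => rw [map_add, Finsupp.add_apply, hx, hy]; simp only [Finsupp.add_apply]; ring
  | single p c =>
    obtain ⟨k, l⟩ := p
    have hc : (Finsupp.single (k, l) c : OpFin) = c • Finsupp.single (k, l) 1 := by simp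
    rw [hc, map_smul, genFin_single]
    simp only [Finsupp.smul_apply, Finsupp.sub_apply, Finsupp.add_apply, Finsupp.single_apply,
      Prod.mk.injEq, smul_eq_mul]
    have e1 : (if k - 1 = m ∧ l - 1 = n then ((edgeAmp h β k * edgeAmp h β l : ℝ) : ℂ) else 0) =
        ((edgeAmp h β (m + 1) * edgeAmp h β (n + 1) : ℝ) : ℂ)
          * if k = m + 1 ∧ l = n + 1 then 1 else 0 := by
      rcases k with _ | k
      · simp [edgeAmp_zero]
      rcases l with _ | l
      · simp [edgeAmp_zero]
      by_cases hk : k = m ∧ l = n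
      · obtain ⟨rfl, rfl⟩ := hk; simp
      · simp [hk]
    have e2 : (if k + 1 = m ∧ l + 1 = n then
          ((edgeAmp h β (k + 1) * edgeAmp h β (l + 1) : ℝ) : ℂ) else 0) =
        ((edgeAmp h β m * edgeAmp h β n : ℝ) : ℂ) * if k = m - 1 ∧ l = n - 1 then 1 else 0 := by
      rcases m with _ | m
      · simp [edgeAmp_zero]
      rcases n with _ | n
      · simp [edgeAmp_zero]
      by_cases hk : k = m ∧ l = n
      · obtain ⟨rfl, rfl⟩ := hk; simp
      · simp [hk]
    have e3 : (if k = m ∧ l = n then ((levelRate h β k + levelRate h β l : ℝ) : ℂ) else 0) =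
        ((levelRate h β m + levelRate h β n : ℝ) : ℂ) * if k = m ∧ l = n then 1 else 0 := by
      by_cases hk : k = m ∧ l = n
      · obtain ⟨rfl, rfl⟩ := hk; simp
      · simp [hk]
    rw [e1, e2, e3]
    ring

theorem inner_toHS_single (x : HilbertSchmidt) (p : ℕ × ℕ) (c : ℂ) :
    inner ℂ x (toHS (Finsupp.single p c)) = conj (x p) * c := by
  rw [toHS, Finsupp.linearCombination_single, inner_smul_right, lp.inner_single_right]
  simp [mul_comm]

theorem inner_genFin_symm (x y : OpFin) :
    inner ℂ (toHS (genFin (metropolis β) h β x)) (toHS y) =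
      inner ℂ (toHS x) (toHS (genFin (metropolis β) h β y)) := by
  classical
  induction x using Finsupp.induction_linear with
  | zero => simp
  | add x x' hx hx' => simp only [map_add, inner_add_left, hx, hx']
  | single p c =>
    induction y using Finsupp.induction_linear with
    | zero => simp
    | add y y' hy hy' => simp only [map_add, inner_add_right, hy, hy']
    | single q d =>
      obtain ⟨k, l⟩ := p
      obtain ⟨m, n⟩ := q
      have hc : (Finsupp.single (k, l) c : OpFin) = c • Finsupp.single (k, l) 1 := by simp
      have hd : (Finsupp.single (m, n) d : OpFin) = d • Finsupp.single (m, n) 1 := by simp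
      rw [inner_toHS_single, ← inner_conj_symm, inner_toHS_single, toHS_apply, toHS_apply,
        hc, hd, map_smul, map_smul, genFin_single h β m n, Finsupp.smul_apply, genFin_apply]
      simp only [Finsupp.smul_apply, Finsupp.sub_apply, Finsupp.add_apply, Finsupp.single_apply,
        Prod.mk.injEq, smul_eq_mul, map_mul, map_sub, map_add, Complex.conj_ofReal,
        Complex.conj_conj, @eq_comm ℕ _ k, @eq_comm ℕ _ l, apply_ite conj, map_one, map_zero]
      split_ifs <;> ring

theorem sum_box_shift {M : ℕ} (F : ℕ → ℕ → ℝ) (h1 : ∀ n, F 0 n = 0) (h2 : ∀ m, F m 0 = 0) :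
    ∑ m ∈ Finset.range (M + 1), ∑ n ∈ Finset.range (M + 1), F m n =
      ∑ m ∈ Finset.range M, ∑ n ∈ Finset.range M, F (m + 1) (n + 1) := by
  rw [Finset.sum_range_succ']
  simp [h1, h2, Finset.sum_range_succ']

theorem sum_box_trim {M : ℕ} (F : ℕ → ℕ → ℝ) (h1 : ∀ n, F M n = 0) (h2 : ∀ m, F m M = 0) :
    ∑ m ∈ Finset.range (M + 1), ∑ n ∈ Finset.range (M + 1), F m n =
      ∑ m ∈ Finset.range M, ∑ n ∈ Finset.range M, F m n := by
  simp [h1, h2, Finset.sum_range_succ]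

/-- The previous entry on the same diagonal. -/
def diagPrev (x : ℕ → ℕ → ℂ) : ℕ → ℕ → ℂ
  | 0, _ => 0
  | _ + 1, 0 => 0
  | m + 1, n + 1 => x m n

/-- The contribution to the form of the edge which ends in `(m, n)`. -/
def edgeForm (x : ℕ → ℕ → ℂ) (m n : ℕ) : ℝ :=
  (downRate h β m + downRate h β n) / 2 * ‖x m n‖ ^ 2
    + (upRate h β m + upRate h β n) / 2 * ‖diagPrev x m n‖ ^ 2
    - 2 * (edgeAmp h β m * edgeAmp h β n) * (conj (x m n) * diagPrev x m n).re

/-- Summation by parts: down rates stay with the edge ending in `(m, n)`, up rates move to the next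
edge of the diagonal. The extra layer in `M + 1` contains the edges that leave the support. -/
theorem re_inner_genFin (x : OpFin) {M : ℕ} (hM : ∀ m n, M ≤ m ∨ M ≤ n → x (m, n) = 0) :
    -(inner ℂ (toHS (genFin (metropolis β) h β x)) (toHS x)).re =
      ∑ m ∈ Finset.range (M + 1), ∑ n ∈ Finset.range (M + 1),
        edgeForm h β (fun m n => x (m, n)) m n := by
  have h1 : inner ℂ (toHS (genFin (metropolis β) h β x)) (toHS x) =
      ∑ m ∈ Finset.range (M + 1), ∑ n ∈ Finset.range (M + 1),
        conj (genFin (metropolis β) h β x (m, n)) * x (m, n) := by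
    rw [lp.inner_eq_tsum, ← Finset.sum_product', tsum_eq_sum (s := Finset.range (M + 1)
      ×ˢ Finset.range (M + 1))]
    · refine Finset.sum_congr rfl fun p _ => ?_
      rw [toHS_apply, toHS_apply, RCLike.inner_apply, mul_comm]
    · rintro ⟨m, n⟩ hp
      rw [toHS_apply, toHS_apply, hM m n, inner_zero_right]
      simp only [Finset.mem_product, Finset.mem_range, not_and_or, not_lt] at hp
      omega
  set X : ℕ → ℕ → ℂ := fun m n => x (m, n) with hX
  have h2 : ∀ m n, (conj (genFin (metropolis β) h β x (m, n)) * x (m, n)).re =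
      edgeAmp h β (m + 1) * edgeAmp h β (n + 1) * (conj (X (m + 1) (n + 1)) * X m n).re
      + edgeAmp h β m * edgeAmp h β n * (conj (X m n) * diagPrev X m n).re
      - (levelRate h β m + levelRate h β n) * ‖X m n‖ ^ 2 := by
    intro m n
    have h3 : edgeAmp h β m * edgeAmp h β n * (conj (X m n) * diagPrev X m n).re =
        edgeAmp h β m * edgeAmp h β n * (conj (X m n) * X (m - 1) (n - 1)).re := by
      rcases m with _ | m
      · simp [edgeAmp_zero]
      rcases n with _ | n
      · simp [edgeAmp_zero]
      rfl
    rw [h3, genFin_apply, ← Complex.normSq_eq_norm_sq, Complex.normSq_apply]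
    simp only [hX, map_sub, map_add, map_mul, Complex.conj_ofReal, Complex.mul_re, Complex.sub_re,
      Complex.add_re, Complex.sub_im, Complex.add_im, Complex.mul_im, Complex.ofReal_re,
      Complex.ofReal_im, Complex.conj_re, Complex.conj_im]
    ring
  have hXM : ∀ m n, M ≤ m ∨ M ≤ n → X m n = 0 := hM
  have h4 : ∑ m ∈ Finset.range (M + 1), ∑ n ∈ Finset.range (M + 1),
      edgeAmp h β (m + 1) * edgeAmp h β (n + 1) * (conj (X (m + 1) (n + 1)) * X m n).re =
      ∑ m ∈ Finset.range (M + 1), ∑ n ∈ Finset.range (M + 1),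
        edgeAmp h β m * edgeAmp h β n * (conj (X m n) * diagPrev X m n).re := by
    rw [sum_box_trim, sum_box_shift]
    · rfl
    · intro n; simp [edgeAmp_zero]
    · intro n; simp [edgeAmp_zero]
    · intro n; simp [hXM M n]
    · intro n; simp [hXM n M]
  have h5 : ∑ m ∈ Finset.range (M + 1), ∑ n ∈ Finset.range (M + 1),
      (upRate h β (m + 1) + upRate h β (n + 1)) / 2 * ‖X m n‖ ^ 2 =
      ∑ m ∈ Finset.range (M + 1), ∑ n ∈ Finset.range (M + 1),
        (upRate h β m + upRate h β n) / 2 * ‖diagPrev X m n‖ ^ 2 := by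
    rw [sum_box_trim, sum_box_shift]
    · rfl
    · intro n; simp [diagPrev]
    · rintro (_ | n) <;> simp [diagPrev]
    · intro n; simp [hXM M n]
    · intro n; simp [hXM n M]
  rw [h1]
  simp only [Complex.re_sum, h2, Finset.sum_sub_distrib, Finset.sum_add_distrib]
  rw [h4]
  have h6 : ∀ m n, (levelRate h β m + levelRate h β n) * ‖X m n‖ ^ 2 =
      (downRate h β m + downRate h β n) / 2 * ‖X m n‖ ^ 2
      + (upRate h β (m + 1) + upRate h β (n + 1)) / 2 * ‖X m n‖ ^ 2 := fun m n => by
    simp only [levelRate]; ring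
  simp only [h6, edgeForm, Finset.sum_sub_distrib, Finset.sum_add_distrib, h5]
  have h7 : ∀ m n, 2 * (edgeAmp h β m * edgeAmp h β n) * (conj (X m n) * diagPrev X m n).re =
      edgeAmp h β m * edgeAmp h β n * (conj (X m n) * diagPrev X m n).re
      + edgeAmp h β m * edgeAmp h β n * (conj (X m n) * diagPrev X m n).re := fun m n => by ring
  simp only [h7, Finset.sum_add_distrib]
  ring

theorem norm_sub_smul_inv_sq (X y : ℂ) {u : ℝ} (hu : 0 < u) :
    ‖(u : ℂ) * X - ((u⁻¹ : ℝ) : ℂ) * y‖ ^ 2 =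
      u ^ 2 * ‖X‖ ^ 2 + (u ^ 2)⁻¹ * ‖y‖ ^ 2 - 2 * (conj X * y).re := by
  simp only [← Complex.normSq_eq_norm_sq, Complex.normSq_apply, Complex.mul_re, Complex.sub_re,
    Complex.sub_im, Complex.mul_im, Complex.ofReal_re, Complex.ofReal_im, Complex.conj_re,
    Complex.conj_im]
  field_simp
  ring

/-- The ratios `u` and `v` belong to unrelated edges and need no comparison: half of the `u`-part
and all of the `v`-part are bounded by AM–GM in terms of `‖X‖ * ‖y‖`, which pays for the remaining
cross term since `2ab ≤ a² + b²`. -/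
theorem edge_lower_bound (X y : ℂ) {a b u v : ℝ} (ha : 0 ≤ a) (hb : 0 ≤ b) (hu : 0 < u)
    (hv : 0 < v) :
    a ^ 2 * ‖(u : ℂ) * X - ((u⁻¹ : ℝ) : ℂ) * y‖ ^ 2 / 4 ≤
      (a ^ 2 * u ^ 2 + b ^ 2 * v ^ 2) / 2 * ‖X‖ ^ 2
      + (a ^ 2 * (u ^ 2)⁻¹ + b ^ 2 * (v ^ 2)⁻¹) / 2 * ‖y‖ ^ 2
      - 2 * (a * b) * (conj X * y).re := by
  rw [norm_sub_smul_inv_sq X y hu]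
  set R := (conj X * y).re
  have hR : |R| ≤ ‖X‖ * ‖y‖ := by
    have := Complex.abs_re_le_norm (conj X * y)
    rwa [norm_mul, Complex.norm_conj] at this
  have amgm : ∀ w : ℝ, 0 < w → 2 * (‖X‖ * ‖y‖) ≤ w ^ 2 * ‖X‖ ^ 2 + (w ^ 2)⁻¹ * ‖y‖ ^ 2 := by
    intro w hw
    have h1 : w * w⁻¹ = 1 := mul_inv_cancel₀ hw.ne'
    rw [← inv_pow]
    have h2 : (w * ‖X‖ - w⁻¹ * ‖y‖) ^ 2 =
        w ^ 2 * ‖X‖ ^ 2 + w⁻¹ ^ 2 * ‖y‖ ^ 2 - 2 * (w * w⁻¹) * (‖X‖ * ‖y‖) := by ring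
    rw [h1] at h2
    linarith [sq_nonneg (w * ‖X‖ - w⁻¹ * ‖y‖)]
  have h1 := mul_le_mul_of_nonneg_left (amgm u hu) (sq_nonneg a)
  have h2 := mul_le_mul_of_nonneg_left (amgm v hv) (sq_nonneg b)
  have hXy : 0 ≤ ‖X‖ * ‖y‖ := by positivity
  have h3 : (2 * (a * b) - a ^ 2 / 2) * R ≤ (a ^ 2 / 2 + b ^ 2) * (‖X‖ * ‖y‖) := by
    have h4 : |2 * (a * b) - a ^ 2 / 2| ≤ a ^ 2 / 2 + b ^ 2 := by
      rw [abs_le]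
      constructor
      · nlinarith [mul_nonneg ha hb, sq_nonneg b]
      · nlinarith [sq_nonneg (a - b)]
    calc (2 * (a * b) - a ^ 2 / 2) * R ≤ |2 * (a * b) - a ^ 2 / 2| * |R| := by
          rw [← abs_mul]; exact le_abs_self _
      _ ≤ _ := mul_le_mul h4 hR (abs_nonneg _) (by positivity)
  nlinarith

/-- The ratio `√(s_{n-1} / s_n)` of the square roots of consecutive Gibbs weights. -/
def edgeRatio (n : ℕ) : ℝ := Real.exp (β * (h n - h (n - 1)) / 4)

theorem edgeRatio_pos (n : ℕ) : 0 < edgeRatio h β n := Real.exp_pos _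

theorem edgeRatio_sq (n : ℕ) : edgeRatio h β n ^ 2 = Real.exp (β * (h n - h (n - 1)) / 2) := by
  rw [edgeRatio, ← Real.exp_nat_mul]; congr 1; push_cast; ring

theorem downRate_eq (n : ℕ) : downRate h β n = edgeAmp h β n ^ 2 * edgeRatio h β n ^ 2 := by
  rw [edgeRatio_sq]; rfl

theorem upRate_eq (n : ℕ) : upRate h β n = edgeAmp h β n ^ 2 * (edgeRatio h β n ^ 2)⁻¹ := by
  rw [edgeRatio_sq, ← Real.exp_neg]; rfl

/-- The squared increment along a diagonal, weighted by the edge with the larger index. -/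
def edgeSq (x : ℕ → ℕ → ℂ) (m n : ℕ) : ℝ :=
  edgeAmp h β (max m n) ^ 2 * ‖(edgeRatio h β (max m n) : ℂ) * x m n
    - (((edgeRatio h β (max m n))⁻¹ : ℝ) : ℂ) * diagPrev x m n‖ ^ 2

theorem edgeSq_nonneg (x : ℕ → ℕ → ℂ) (m n : ℕ) : 0 ≤ edgeSq h β x m n := by
  unfold edgeSq; positivity

/-- Along a diagonal the larger coordinate is always the same one and increases by one per step, so
keeping only its edge leaves a one-dimensional chain. -/
theorem edgeSq_le (x : ℕ → ℕ → ℂ) (m n : ℕ) : edgeSq h β x m n / 4 ≤ edgeForm h β x m n := by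
  simp only [edgeSq, edgeForm, downRate_eq, upRate_eq]
  rcases le_total m n with hmn | hmn
  · rw [max_eq_right hmn]
    refine (edge_lower_bound _ _ (edgeAmp_nonneg h β n) (edgeAmp_nonneg h β m)
      (edgeRatio_pos h β n) (edgeRatio_pos h β m)).trans (le_of_eq ?_)
    ring
  · rw [max_eq_left hmn]
    exact edge_lower_bound _ _ (edgeAmp_nonneg h β m) (edgeAmp_nonneg h β n)
      (edgeRatio_pos h β m) (edgeRatio_pos h β n)

end Form

/-! ### A Hardy inequality along the diagonals -/

section Hardy

/-- Geometrically weighted sum of `Y` along the diagonal up to `(m, n)`. -/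
def diagSum (ρ : ℝ) (Y : ℕ → ℕ → ℝ) : ℕ → ℕ → ℝ
  | 0, n => Y 0 n
  | m + 1, 0 => Y (m + 1) 0
  | m + 1, n + 1 => Y (m + 1) (n + 1) + ρ * diagSum ρ Y m n

variable {ρ : ℝ} {Y : ℕ → ℕ → ℝ}

theorem diagSum_nonneg (hρ : 0 ≤ ρ) (hY : ∀ m n, 0 ≤ Y m n) : ∀ m n, 0 ≤ diagSum ρ Y m n
  | 0, n => hY 0 n
  | m + 1, 0 => hY (m + 1) 0
  | m + 1, n + 1 => add_nonneg (hY _ _) (mul_nonneg hρ (diagSum_nonneg hρ hY m n))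

/-- By the recursion the total `D` of `diagSum` satisfies `D ≤ ∑ Y + ρ D`. -/
theorem sum_diagSum_le (hρ : 0 ≤ ρ) (hρ1 : ρ < 1) (hY : ∀ m n, 0 ≤ Y m n) (M : ℕ) :
    ∑ m ∈ Finset.range (M + 1), ∑ n ∈ Finset.range (M + 1), diagSum ρ Y m n ≤
      (∑ m ∈ Finset.range (M + 1), ∑ n ∈ Finset.range (M + 1), Y m n) / (1 - ρ) := by
  have h0 := diagSum_nonneg hρ hY
  have h1 : ∑ m ∈ Finset.range (M + 1), ∑ n ∈ Finset.range (M + 1),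
      (diagSum ρ Y m n - Y m n) = ρ * ∑ m ∈ Finset.range M, ∑ n ∈ Finset.range M,
        diagSum ρ Y m n := by
    rw [sum_box_shift]
    · simp only [diagSum, add_sub_cancel_left, Finset.mul_sum]
    · intro n; simp [diagSum]
    · rintro (_ | m) <;> simp [diagSum]
  have h2 : ∑ m ∈ Finset.range M, ∑ n ∈ Finset.range M, diagSum ρ Y m n ≤
      ∑ m ∈ Finset.range (M + 1), ∑ n ∈ Finset.range (M + 1), diagSum ρ Y m n := by
    have hsub : Finset.range M ⊆ Finset.range (M + 1) := Finset.range_subset_range.2 (Nat.le_succ M)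
    calc _ ≤ ∑ m ∈ Finset.range M, ∑ n ∈ Finset.range (M + 1), diagSum ρ Y m n :=
          Finset.sum_le_sum fun m _ =>
            Finset.sum_le_sum_of_subset_of_nonneg hsub fun n _ _ => h0 m n
      _ ≤ _ := Finset.sum_le_sum_of_subset_of_nonneg hsub fun m _ _ =>
            Finset.sum_nonneg fun n _ => h0 m n
  simp only [Finset.sum_sub_distrib] at h1
  rw [le_div_iff₀ (by linarith)]
  nlinarith [mul_le_mul_of_nonneg_left h2 hρ]

theorem sq_add_le_div {θ A D : ℝ} (h0 : 0 < θ) (h1 : θ < 1) :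
    (A + D) ^ 2 ≤ A ^ 2 / θ + D ^ 2 / (1 - θ) := by
  have h2 : 0 < 1 - θ := by linarith
  rw [div_add_div _ _ h0.ne' h2.ne', le_div_iff₀ (mul_pos h0 h2)]
  nlinarith [sq_nonneg ((1 - θ) * A - θ * D)]

variable {K : ℝ} {s : ℕ → ℝ} {V : ℕ → ℕ → ℂ}

/-- The shift `k` carries the weight of a later level through the induction; `s` need not be
monotone. -/
theorem norm_sq_le_diagSum (hρ : 0 < ρ) (hρ1 : ρ < 1) (hK : 0 ≤ K) (hY : ∀ m n, 0 ≤ Y m n)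
    (hV0 : ∀ m n k, m = 0 ∨ n = 0 →
      s (max m n + k) ^ 2 * ‖V m n‖ ^ 2 ≤ K * ρ ^ (2 * k) * Y m n)
    (hV1 : ∀ m n k, s (max m n + 1 + k) ^ 2 * ‖V (m + 1) (n + 1) - V m n‖ ^ 2 ≤
      K * ρ ^ (2 * k) * Y (m + 1) (n + 1)) (m : ℕ) : ∀ n k,
    s (max m n + k) ^ 2 * ‖V m n‖ ^ 2 ≤ K / (1 - ρ) * ρ ^ (2 * k) * diagSum ρ Y m n := by
  have h1 : 0 < 1 - ρ := by linarith
  have hKρ : K ≤ K / (1 - ρ) := by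
    rw [le_div_iff₀ h1]; nlinarith
  have hb : ∀ m n k, m = 0 ∨ n = 0 →
      s (max m n + k) ^ 2 * ‖V m n‖ ^ 2 ≤ K / (1 - ρ) * ρ ^ (2 * k) * Y m n := by
    intro m n k hmn
    refine (hV0 m n k hmn).trans ?_
    have := hY m n
    gcongr
  induction m with
  | zero => exact fun n k => hb 0 n k (Or.inl rfl)
  | succ m ih =>
    rintro (_ | n) k
    · exact hb (m + 1) 0 k (Or.inr rfl)
    · have hmax : max (m + 1) (n + 1) + k = max m n + 1 + k := by omega
      -- The shift by one gains `ρ²` and the splitting of the square in `h4` costs `1/ρ`; the net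
      -- factor `ρ` is the one in the recursion of `diagSum`.
      have h2 := ih n (1 + k)
      have h3 := hV1 m n k
      rw [← add_assoc] at h2
      have h4 : ‖V (m + 1) (n + 1)‖ ^ 2 ≤
          ‖V m n‖ ^ 2 / ρ + ‖V (m + 1) (n + 1) - V m n‖ ^ 2 / (1 - ρ) := by
        refine le_trans ?_ (sq_add_le_div hρ hρ1)
        have := norm_add_le (V m n) (V (m + 1) (n + 1) - V m n)
        rw [add_sub_cancel] at this
        gcongr
      rw [hmax, diagSum]
      calc s (max m n + 1 + k) ^ 2 * ‖V (m + 1) (n + 1)‖ ^ 2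
          ≤ (s (max m n + 1 + k) ^ 2 * ‖V m n‖ ^ 2) / ρ
            + (s (max m n + 1 + k) ^ 2 * ‖V (m + 1) (n + 1) - V m n‖ ^ 2) / (1 - ρ) := by
            rw [mul_div_assoc, mul_div_assoc, ← mul_add]
            exact mul_le_mul_of_nonneg_left h4 (sq_nonneg _)
        _ ≤ (K / (1 - ρ) * ρ ^ (2 * (1 + k)) * diagSum ρ Y m n) / ρ
            + (K * ρ ^ (2 * k) * Y (m + 1) (n + 1)) / (1 - ρ) := by
            gcongr
        _ = _ := by
            rw [show 2 * (1 + k) = 2 * k + 1 + 1 by ring, pow_succ, pow_succ]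
            field_simp
            ring

theorem diagonal_hardy (hρ : 0 < ρ) (hρ1 : ρ < 1) (hK : 0 ≤ K) (hY : ∀ m n, 0 ≤ Y m n)
    (hV0 : ∀ m n k, m = 0 ∨ n = 0 →
      s (max m n + k) ^ 2 * ‖V m n‖ ^ 2 ≤ K * ρ ^ (2 * k) * Y m n)
    (hV1 : ∀ m n k, s (max m n + 1 + k) ^ 2 * ‖V (m + 1) (n + 1) - V m n‖ ^ 2 ≤
      K * ρ ^ (2 * k) * Y (m + 1) (n + 1)) (M : ℕ) :
    ∑ m ∈ Finset.range (M + 1), ∑ n ∈ Finset.range (M + 1), s (max m n) ^ 2 * ‖V m n‖ ^ 2 ≤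
      K / (1 - ρ) ^ 2 * ∑ m ∈ Finset.range (M + 1), ∑ n ∈ Finset.range (M + 1), Y m n := by
  have h1 : 0 < 1 - ρ := by linarith
  calc _ ≤ ∑ m ∈ Finset.range (M + 1), ∑ n ∈ Finset.range (M + 1),
        K / (1 - ρ) * diagSum ρ Y m n :=
        Finset.sum_le_sum fun m _ => Finset.sum_le_sum fun n _ => by
          simpa using norm_sq_le_diagSum hρ hρ1 hK hY hV0 hV1 m n 0
    _ = K / (1 - ρ) * ∑ m ∈ Finset.range (M + 1), ∑ n ∈ Finset.range (M + 1),
        diagSum ρ Y m n := by simp only [Finset.mul_sum]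
    _ ≤ K / (1 - ρ) * ((∑ m ∈ Finset.range (M + 1), ∑ n ∈ Finset.range (M + 1), Y m n)
        / (1 - ρ)) :=
        mul_le_mul_of_nonneg_left (sum_diagSum_le hρ.le hρ1 hY M) (div_nonneg hK h1.le)
    _ = _ := by field_simp

end Hardy

/-! ### Growth of the energy levels -/

section Growth

variable {h : ℕ → ℝ} {β δ Δ : ℝ} {n₀ s : ℕ}

/-- The defect in the linear growth of the energy levels. -/
def growthDefect (n₀ : ℕ) (δ : ℝ) (s : ℕ) (Δ : ℝ) : ℝ := Δ + 2 * n₀ * (δ / s) + δ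

theorem energySpread_ge (h : ℕ → ℝ) {n₀ i j : ℕ} (hi : i ≤ 2 * n₀) (hj : j ≤ 2 * n₀) :
    |h i - h j| ≤ energySpread h n₀ :=
  Finset.le_sup' (fun p : ℕ × ℕ => |h p.1 - h p.2|) (b := (i, j))
    (by simp only [Finset.mem_product, Finset.mem_range]; omega)

theorem energy_growth_tail (hδ : 0 < δ) (hs : 0 < s) (hmono : MonotoneOn h (Set.Ici n₀))
    (hgrow : ∀ m, n₀ ≤ m → δ ≤ h (m + s) - h m) {i N : ℕ} (hi : n₀ ≤ i) (hN : i ≤ N) :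
    h i + ((N : ℝ) - i) * (δ / s) - δ ≤ h N := by
  have hblock : ∀ k : ℕ, h i + k * δ ≤ h (i + s * k) := fun k => by
    induction k with
    | zero => simp
    | succ k ih =>
      have := hgrow (i + s * k) (by omega)
      rw [show i + s * (k + 1) = i + s * k + s by ring]
      push_cast
      linarith
  have h1 := hblock ((N - i) / s)
  have h2 : s * ((N - i) / s) ≤ N - i := Nat.mul_div_le _ _
  have h3 : h (i + s * ((N - i) / s)) ≤ h N :=
    hmono (Set.mem_Ici.2 (by omega)) (Set.mem_Ici.2 (by omega)) (by omega)
  have h4 : N - i < s * ((N - i) / s + 1) := by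
    have := Nat.lt_div_mul_add (a := N - i) hs
    rw [mul_add, mul_comm s]; omega
  have h5 : (N : ℝ) - i ≤ s * (((N - i) / s : ℕ) + 1) := by
    rw [← Nat.cast_sub hN]; exact_mod_cast h4.le
  have h6 : (0 : ℝ) < s := by exact_mod_cast hs
  have h7 : ((N : ℝ) - i) * (δ / s) ≤ (((N - i) / s : ℕ) + 1) * δ := by
    rw [mul_div_assoc', div_le_iff₀ h6]
    nlinarith
  linarith

/-- In the defect, `δ` pays for an incomplete block of length `s`, `Δ` for the disorder among the
low levels, and `2 n₀ (δ / s)` for the growth missing below `n₀`. -/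
theorem energy_growth (hδ : 0 < δ) (hs : 0 < s) (hmono : MonotoneOn h (Set.Ici n₀))
    (hgrow : ∀ m, n₀ ≤ m → δ ≤ h (m + s) - h m) (hΔ : energySpread h n₀ = Δ) {i N : ℕ}
    (hN : i ≤ N) : h i + ((N : ℝ) - i) * (δ / s) - growthDefect n₀ δ s Δ ≤ h N := by
  have h6 : 0 < δ / s := div_pos hδ (by exact_mod_cast hs)
  have h0 : 0 ≤ Δ := by
    rw [← hΔ]; exact (abs_nonneg _).trans (energySpread_ge h (Nat.zero_le _) (Nat.zero_le _))
  have h7 : 0 ≤ 2 * n₀ * (δ / s) := by positivity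
  have h8 : (0 : ℝ) ≤ i := Nat.cast_nonneg i
  unfold growthDefect
  by_cases hi : n₀ ≤ i
  · have := energy_growth_tail hδ hs hmono hgrow hi hN
    linarith
  · by_cases hN0 : N < n₀
    · have h1 := (abs_le.1 (energySpread_ge h (i := i) (j := N) (n₀ := n₀)
        (by omega) (by omega))).2
      have h2 : (N : ℝ) - i ≤ 2 * n₀ := by
        have : (N : ℝ) ≤ n₀ := by exact_mod_cast hN0.le
        have : (0 : ℝ) ≤ n₀ := Nat.cast_nonneg _
        linarith
      have h3 := mul_le_mul_of_nonneg_right h2 h6.le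
      linarith
    · have h1 := (abs_le.1 (energySpread_ge h (i := i) (j := n₀) (n₀ := n₀)
        (by omega) (by omega))).2
      have h2 := energy_growth_tail hδ hs hmono hgrow le_rfl (not_lt.1 hN0)
      have h3 : (N : ℝ) - i ≤ 2 * n₀ + (N - n₀) := by
        have : (0 : ℝ) ≤ n₀ := Nat.cast_nonneg _
        linarith
      have h4 := mul_le_mul_of_nonneg_right h3 h6.le
      linarith

/-- The decay rate of the square roots of the Gibbs weights. -/
def decayRate (β δ : ℝ) (s : ℕ) : ℝ := Real.exp (-(β * (δ / s) / 2))

theorem decayRate_pow (β δ : ℝ) (s k : ℕ) :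
    decayRate β δ s ^ (2 * k) = Real.exp (-(k * (β * (δ / s)))) := by
  rw [decayRate, ← Real.exp_nat_mul]; congr 1; push_cast; ring

theorem decayRate_lt_one (hβ : 0 < β) (hδ : 0 < δ) (hs : 0 < s) : decayRate β δ s < 1 := by
  have : (0 : ℝ) < s := by exact_mod_cast hs
  rw [decayRate, Real.exp_lt_one_iff, neg_lt_zero]
  positivity

theorem hasGibbsState (hβ : 0 < β) (hδ : 0 < δ) (hs : 0 < s) (hmono : MonotoneOn h (Set.Ici n₀))
    (hgrow : ∀ m, n₀ ≤ m → δ ≤ h (m + s) - h m) : HasGibbsState h β := by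
  have h1 : Summable fun n => Real.exp (β * (growthDefect n₀ δ s (energySpread h n₀) - h 0))
      * (decayRate β δ s ^ 2) ^ n := by
    refine (summable_geometric_of_lt_one (sq_nonneg _) ?_).mul_left _
    exact pow_lt_one₀ (Real.exp_pos _).le (decayRate_lt_one hβ hδ hs) two_ne_zero
  refine Summable.of_nonneg_of_le (fun n => (Real.exp_pos _).le) (fun n => ?_) h1
  rw [← pow_mul, decayRate_pow, ← Real.exp_add, Real.exp_le_exp]
  have h2 := energy_growth hδ hs hmono hgrow rfl (Nat.zero_le n)
  rw [Nat.cast_zero, sub_zero] at h2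
  nlinarith [mul_le_mul_of_nonneg_left h2 hβ.le]

/-- The square root of a Gibbs weight. -/
def gibbsAmp (h : ℕ → ℝ) (β : ℝ) (n : ℕ) : ℝ := Real.sqrt (Real.exp (-(β * h n)) / partitionFn h β)

theorem gibbsAmp_pos (hZ : HasGibbsState h β) (n : ℕ) : 0 < gibbsAmp h β n :=
  Real.sqrt_pos.2 (div_pos (Real.exp_pos _) (partitionFn_pos hZ))

theorem gibbsAmp_sq (hZ : HasGibbsState h β) (n : ℕ) :
    gibbsAmp h β n ^ 2 = Real.exp (-(β * h n)) / partitionFn h β :=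
  Real.sq_sqrt (div_pos (Real.exp_pos _) (partitionFn_pos hZ)).le

theorem gibbsAmp_succ (n : ℕ) :
    gibbsAmp h β (n + 1) * edgeRatio h β (n + 1) ^ 2 = gibbsAmp h β n := by
  have h1 : ∀ m, gibbsAmp h β m = Real.exp (-(β * h m) / 2) / Real.sqrt (partitionFn h β) := by
    intro m
    rw [gibbsAmp, Real.sqrt_div (Real.exp_pos _).le, Real.exp_half]
  rw [h1, h1, edgeRatio_sq, div_mul_eq_mul_div, ← Real.exp_add, Nat.add_sub_cancel]
  congr 2; ring

theorem edgeAmp_sq (h : ℕ → ℝ) (β : ℝ) (n : ℕ) : edgeAmp h β n ^ 2 =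
    Real.exp (-(Real.sqrt (1 + (β * (h n - h (n - 1))) ^ 2) / 2)) * n := by
  rw [edgeAmp, mul_pow, Real.sq_sqrt (Nat.cast_nonneg n), filterAmp, ← Real.exp_nat_mul]
  congr 2; push_cast; ring

/-- The constant in the comparison of Gibbs weights. -/
def weightConst (β : ℝ) (n₀ : ℕ) (δ : ℝ) (s : ℕ) (Δ : ℝ) : ℝ :=
  Real.exp (1 / 2 + β * growthDefect n₀ δ s Δ)

/-- As `√(1 + t²) ≤ 1 + |t|`, the edge weight on the right is at least `e^{-1/2}` times the smaller
of the Gibbs weights at `i - 1` and `i`. The level at `i + k` lies above both by linear growth. -/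
theorem gibbsAmp_sq_le (hβ : 0 < β) (hδ : 0 < δ) (hs : 0 < s)
    (hmono : MonotoneOn h (Set.Ici n₀)) (hgrow : ∀ m, n₀ ≤ m → δ ≤ h (m + s) - h m)
    (hΔ : energySpread h n₀ = Δ) (hZ : HasGibbsState h β) {i : ℕ} (hi : 1 ≤ i) (k : ℕ) :
    gibbsAmp h β (i + k) ^ 2 ≤ weightConst β n₀ δ s Δ * decayRate β δ s ^ (2 * k)
      * (edgeAmp h β i ^ 2 * edgeRatio h β i ^ 2) * gibbsAmp h β i ^ 2 := by
  have hp : 0 < δ / s := div_pos hδ (by exact_mod_cast hs)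
  rw [gibbsAmp_sq hZ, gibbsAmp_sq hZ, mul_div_assoc']
  refine div_le_div_of_nonneg_right ?_ (partitionFn_pos hZ).le
  rw [edgeAmp_sq, edgeRatio_sq, decayRate_pow, weightConst]
  set d := h i - h (i - 1) with hd
  have h1 : (1 : ℝ) ≤ i := by exact_mod_cast hi
  have h2 : Real.sqrt (1 + (β * d) ^ 2) ≤ 1 + |β * d| := by
    rw [Real.sqrt_le_left (by positivity)]
    nlinarith [abs_nonneg (β * d), sq_abs (β * d)]
  have g1 := energy_growth hδ hs hmono hgrow hΔ (i := i) (N := i + k) (by omega)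
  have g2 := energy_growth hδ hs hmono hgrow hΔ (i := i - 1) (N := i + k) (by omega)
  rw [Nat.cast_sub hi] at g2
  push_cast at g1 g2
  have g1' := mul_le_mul_of_nonneg_left g1 hβ.le
  have g2' := mul_le_mul_of_nonneg_left g2 hβ.le
  have hp' : 0 < β * (δ / s) := mul_pos hβ hp
  have h3 : -(β * h (i + k)) ≤ 1 / 2 + β * growthDefect n₀ δ s Δ + -(k * (β * (δ / s)))
      + (-(Real.sqrt (1 + (β * d) ^ 2) / 2) + β * d / 2) + -(β * h i) := by
    -- For `d ≥ 0` the smaller weight sits at `i`, otherwise at `i - 1`.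
    rcases le_total 0 d with h0 | h0
    · rw [abs_of_nonneg (mul_nonneg hβ.le h0)] at h2
      nlinarith
    · rw [abs_of_nonpos (mul_nonpos_of_nonneg_of_nonpos hβ.le h0)] at h2
      have h4 : h (i - 1) = h i - d := by rw [hd]; ring
      rw [h4] at g2'
      nlinarith
  calc Real.exp (-(β * h (i + k))) ≤ _ := Real.exp_le_exp.2 h3
    _ = Real.exp (1 / 2 + β * growthDefect n₀ δ s Δ) * Real.exp (-(k * (β * (δ / s))))
        * (Real.exp (-(Real.sqrt (1 + (β * d) ^ 2) / 2)) * 1 * Real.exp (β * d / 2))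
        * Real.exp (-(β * h i)) := by
        rw [mul_one, Real.exp_add, Real.exp_add, Real.exp_add, Real.exp_add, Real.exp_add]
    _ ≤ _ := by gcongr

end Growth

/-! ### The gap inequality on the core -/

section Core

variable {h : ℕ → ℝ} {β δ Δ : ℝ} {n₀ s : ℕ}

theorem sqrtGibbs_apply (hZ : HasGibbsState h β) (m n : ℕ) :
    sqrtGibbs hZ (m, n) = if m = n then (gibbsAmp h β m : ℂ) else 0 := rfl

theorem norm_sqrtGibbs (hZ : HasGibbsState h β) : ‖sqrtGibbs hZ‖ = 1 := by
  have h1 := lp.norm_rpow_eq_tsum (p := 2) (by norm_num) (sqrtGibbs hZ)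
  have hinj : Function.Injective fun n : ℕ => (n, n) := fun a b hab => (Prod.ext_iff.1 hab).1
  have hsupp : (Function.support fun p => ‖sqrtGibbs hZ p‖ ^ (2 : ENNReal).toReal) ⊆
      Set.range fun n : ℕ => (n, n) := by
    rintro ⟨m, n⟩ hp
    by_cases hmn : m = n
    · exact ⟨m, by simp [hmn]⟩
    · exact absurd (by simp [sqrtGibbs_apply, hmn]) hp
  rw [← hinj.tsum_eq hsupp] at h1
  have h2 : ∀ n, ‖sqrtGibbs hZ (n, n)‖ ^ (2 : ENNReal).toReal =
      Real.exp (-(β * h n)) / partitionFn h β := fun n => by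
    rw [sqrtGibbs_apply, if_pos rfl, ENNReal.toReal_ofNat, Real.rpow_ofNat, Complex.norm_real,
      Real.norm_eq_abs, sq_abs, gibbsAmp_sq hZ]
  simp only [h2, tsum_div_const] at h1
  rw [ENNReal.toReal_ofNat, Real.rpow_ofNat] at h1
  have h3 : ‖sqrtGibbs hZ‖ ^ 2 = 1 := h1.trans (div_self (partitionFn_pos hZ).ne')
  exact (pow_eq_one_iff_of_nonneg (norm_nonneg _) two_ne_zero).1 h3

/-- Detailed balance: `s_{m-1}` and `s_{m+1}` times the squared edge amplitudes equal `s_m` times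
the down and up rates. This makes the extension of the generator by `0` on `√σ_β` symmetric. -/
theorem inner_sqrtGibbs_genFin (hZ : HasGibbsState h β) (x : OpFin) :
    inner ℂ (sqrtGibbs hZ) (toHS (genFin (metropolis β) h β x)) = 0 := by
  induction x using Finsupp.induction_linear with
  | zero => simp
  | add x y hx hy => rw [map_add, map_add, inner_add_right, hx, hy, add_zero]
  | single p c =>
    obtain ⟨m, n⟩ := p
    have hc : (Finsupp.single (m, n) c : OpFin) = c • Finsupp.single (m, n) 1 := by simp
    rw [hc, map_smul, map_smul, inner_smul_right, genFin_single, map_sub, map_add, inner_sub_right,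
      inner_add_right, inner_toHS_single, inner_toHS_single, inner_toHS_single, sqrtGibbs_apply,
      sqrtGibbs_apply, sqrtGibbs_apply]
    refine mul_eq_zero_of_right _ ?_
    by_cases hmn : m = n
    · subst hmn
      simp only [if_true, Complex.conj_ofReal]
      have h1 : gibbsAmp h β (m - 1) * (edgeAmp h β m * edgeAmp h β m) =
          gibbsAmp h β m * downRate h β m := by
        rcases m with _ | m
        · simp [edgeAmp_zero, downRate]
        · rw [downRate_eq, Nat.add_sub_cancel, ← gibbsAmp_succ]; ring
      have h2 : gibbsAmp h β (m + 1) * (edgeAmp h β (m + 1) * edgeAmp h β (m + 1)) =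
          gibbsAmp h β m * upRate h β (m + 1) := by
        rw [upRate_eq, ← gibbsAmp_succ (n := m)]
        have := (edgeRatio_pos h β (m + 1)).ne'
        field_simp
      rw [← Complex.ofReal_mul, h1, ← Complex.ofReal_mul, h2, ← Complex.ofReal_mul,
        ← Complex.ofReal_add, ← Complex.ofReal_sub, Complex.ofReal_eq_zero, levelRate]
      ring
    · have h1 : ¬ (m + 1 = n + 1) := by omega
      rw [if_neg hmn, if_neg h1]
      rcases m with _ | m
      · simp [edgeAmp_zero]
      rcases n with _ | n
      · simp [edgeAmp_zero]
      have h2 : ¬ (m + 1 - 1 = n + 1 - 1) := by omega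
      rw [if_neg h2]
      simp

theorem exists_box (x : OpFin) : ∃ M, ∀ m n, M ≤ m ∨ M ≤ n → x (m, n) = 0 := by
  obtain ⟨M, hM⟩ := (x.support.image fun p => max p.1 p.2).exists_nat_subset_range
  refine ⟨M, fun m n hmn => ?_⟩
  by_contra hne
  have := Finset.mem_range.1 (hM (Finset.mem_image_of_mem _ (Finsupp.mem_support_iff.2 hne)))
  simp only at this
  omega

/-- The lower bound for the spectral gap. -/
def gapConst (β : ℝ) (n₀ : ℕ) (δ : ℝ) (s : ℕ) (Δ : ℝ) : ℝ :=
  (1 - decayRate β δ s) ^ 2 / (4 * weightConst β n₀ δ s Δ)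

theorem gapConst_pos (hβ : 0 < β) (hδ : 0 < δ) (hs : 0 < s) : 0 < gapConst β n₀ δ s Δ :=
  div_pos (pow_pos (sub_pos.2 (decayRate_lt_one hβ hδ hs)) 2)
    (mul_pos four_pos (Real.exp_pos _))

theorem norm_sub_smul_sqrtGibbs_le (hβ : 0 < β) (hδ : 0 < δ) (hs : 0 < s)
    (hmono : MonotoneOn h (Set.Ici n₀)) (hgrow : ∀ m, n₀ ≤ m → δ ≤ h (m + s) - h m)
    (hΔ : energySpread h n₀ = Δ) (hZ : HasGibbsState h β) (x : OpFin) :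
    ∃ c : ℂ, gapConst β n₀ δ s Δ * ‖toHS x - c • sqrtGibbs hZ‖ ^ 2 ≤
      -(inner ℂ (toHS (genFin (metropolis β) h β x)) (toHS x)).re := by
  set Q := -(inner ℂ (toHS (genFin (metropolis β) h β x)) (toHS x)).re with hQ
  set ρ := decayRate β δ s with hρdef
  set K := weightConst β n₀ δ s Δ with hKdef
  have hρ : 0 < ρ := Real.exp_pos _
  have hρ1 : ρ < 1 := decayRate_lt_one hβ hδ hs
  have hK : 0 < K := Real.exp_pos _
  obtain ⟨M, hM⟩ := exists_box x
  set X : ℕ → ℕ → ℂ := fun m n => x (m, n) with hX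
  -- No edge enters `(0, 0)`, so the Hardy inequality needs `V 0 0 = 0` there. This `c` is not the
  -- orthogonal projection coefficient; `norm_sq_sub_inner_sq_le` allows any.
  set c : ℂ := x (0, 0) / gibbsAmp h β 0 with hc
  set W := toHS x - c • sqrtGibbs hZ with hW
  have hWa : ∀ m n, W (m, n) = X m n - c * (if m = n then (gibbsAmp h β m : ℂ) else 0) := by
    intro m n
    rw [hW, lp.coeFn_sub, Pi.sub_apply, lp.coeFn_smul, Pi.smul_apply, toHS_apply, sqrtGibbs_apply,
      smul_eq_mul]
  have hs0 : ∀ n, gibbsAmp h β n ≠ 0 := fun n => (gibbsAmp_pos hZ n).ne'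
  have hs0' : ∀ n, (gibbsAmp h β n : ℂ) ≠ 0 := fun n => Complex.ofReal_ne_zero.2 (hs0 n)
  -- The subtracted multiple of `√σ_β` becomes the constant `c` on the main diagonal and leaves all
  -- increments of `V` unchanged.
  set V : ℕ → ℕ → ℂ := fun m n => W (m, n) / gibbsAmp h β (max m n) with hV
  have hVa : ∀ m n, V m n = X m n / gibbsAmp h β (max m n) - if m = n then c else 0 := by
    intro m n
    simp only [hV, hWa]
    by_cases hmn : m = n
    · subst hmn
      have := hs0' m
      simp only [if_true, max_self]
      field_simp
    · simp [hmn]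
  have hY := edgeSq_nonneg h β X
  have hnorm : ∀ m n, gibbsAmp h β (max m n) ^ 2 * ‖V m n‖ ^ 2 = ‖W (m, n)‖ ^ 2 := by
    intro m n
    rw [hV]
    simp only [norm_div, Complex.norm_real, Real.norm_eq_abs, div_pow, sq_abs]
    exact mul_div_cancel₀ _ (pow_ne_zero 2 (hs0 _))
  have hwt := fun (i : ℕ) (hi : 1 ≤ i) => gibbsAmp_sq_le hβ hδ hs hmono hgrow hΔ hZ hi
  have hstep : ∀ i k (y : ℂ), 1 ≤ i → gibbsAmp h β (i + k) ^ 2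
      * ‖y / (edgeRatio h β i * gibbsAmp h β i)‖ ^ 2 ≤
        K * ρ ^ (2 * k) * (edgeAmp h β i ^ 2 * ‖y‖ ^ 2) := by
    intro i k y hi
    have h1 := hwt i hi k
    have h2 := hs0 i
    have h3 := (edgeRatio_pos h β i).ne'
    rw [norm_div, norm_mul, Complex.norm_real, Complex.norm_real, Real.norm_eq_abs,
      Real.norm_eq_abs, div_pow, mul_pow, sq_abs, sq_abs, mul_div_assoc',
      div_le_iff₀ (by positivity)]
    calc gibbsAmp h β (i + k) ^ 2 * ‖y‖ ^ 2 ≤ _ := mul_le_mul_of_nonneg_right h1 (sq_nonneg _)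
      _ = _ := by ring
  have hV0 : ∀ m n k, m = 0 ∨ n = 0 →
      gibbsAmp h β (max m n + k) ^ 2 * ‖V m n‖ ^ 2 ≤ K * ρ ^ (2 * k) * edgeSq h β X m n := by
    intro m n k hmn
    by_cases h00 : max m n = 0
    · obtain ⟨rfl, rfl⟩ : m = 0 ∧ n = 0 := by omega
      have : V 0 0 = 0 := by
        rw [hVa]; simp [hc, hX]
      rw [this, norm_zero, zero_pow two_ne_zero, mul_zero]
      exact mul_nonneg (mul_nonneg hK.le (pow_nonneg hρ.le _)) (hY 0 0)
    · have hne : m ≠ n := by omega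
      have hp : diagPrev X m n = 0 := by
        rcases hmn with rfl | rfl
        · rfl
        · cases m <;> rfl
      have h3 : (edgeRatio h β (max m n) : ℂ) ≠ 0 :=
        Complex.ofReal_ne_zero.2 (edgeRatio_pos h β _).ne'
      have := hstep (max m n) k (edgeRatio h β (max m n) * X m n) (by omega)
      rw [mul_div_mul_left _ _ h3] at this
      rw [hVa, if_neg hne, sub_zero, edgeSq, hp, mul_zero, sub_zero]
      exact this
  have hV1 : ∀ m n k, gibbsAmp h β (max m n + 1 + k) ^ 2 * ‖V (m + 1) (n + 1) - V m n‖ ^ 2 ≤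
      K * ρ ^ (2 * k) * edgeSq h β X (m + 1) (n + 1) := by
    intro m n k
    have hmax : max (m + 1) (n + 1) = max m n + 1 := by omega
    have h1 := hstep (max m n + 1) k (edgeRatio h β (max m n + 1) * X (m + 1) (n + 1)
      - (((edgeRatio h β (max m n + 1))⁻¹ : ℝ) : ℂ) * X m n) (by omega)
    have h2 : V (m + 1) (n + 1) - V m n = (edgeRatio h β (max m n + 1) * X (m + 1) (n + 1)
      - (((edgeRatio h β (max m n + 1))⁻¹ : ℝ) : ℂ) * X m n) /
        (edgeRatio h β (max m n + 1) * gibbsAmp h β (max m n + 1)) := by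
      have h3 : (edgeRatio h β (max m n + 1) : ℂ) ≠ 0 :=
        Complex.ofReal_ne_zero.2 (edgeRatio_pos h β _).ne'
      have h4 := hs0' (max m n + 1)
      rw [hVa, hVa, hmax, ← gibbsAmp_succ (n := max m n)]
      simp only [Nat.add_right_cancel_iff, sub_sub_sub_cancel_right]
      push_cast
      field_simp
    rw [h2, edgeSq, hmax]
    exact h1
  -- `W` has infinite support because of `√σ_β`, so the bound is needed on arbitrarily large boxes.
  have hbox : ∀ J, M ≤ J → ∑ m ∈ Finset.range (J + 1), ∑ n ∈ Finset.range (J + 1),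
      ‖W (m, n)‖ ^ 2 ≤ K / (1 - ρ) ^ 2 * (4 * Q) := by
    intro J hJ
    have h1 := diagonal_hardy hρ hρ1 hK.le hY hV0 hV1 J
    simp only [hnorm] at h1
    refine h1.trans (mul_le_mul_of_nonneg_left ?_ (by positivity))
    rw [hQ, re_inner_genFin h β x (M := J) fun m n hmn => hM m n (by omega), Finset.mul_sum]
    refine Finset.sum_le_sum fun m _ => ?_
    rw [Finset.mul_sum]
    refine Finset.sum_le_sum fun n _ => ?_
    linarith [edgeSq_le h β X m n]
  have hpos : 0 ≤ K / (1 - ρ) ^ 2 * (4 * Q) :=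
    (Finset.sum_nonneg fun m _ => Finset.sum_nonneg fun n _ => sq_nonneg _).trans (hbox M le_rfl)
  have hfin : ‖W‖ ≤ Real.sqrt (K / (1 - ρ) ^ 2 * (4 * Q)) := by
    refine lp.norm_le_of_forall_sum_le (by norm_num) (Real.sqrt_nonneg _) fun S => ?_
    obtain ⟨J, hJ⟩ := (S.image fun p => max p.1 p.2).exists_nat_subset_range
    simp only [ENNReal.toReal_ofNat, Real.rpow_ofNat]
    rw [Real.sq_sqrt hpos]
    refine le_trans ?_ (hbox (max M J) (le_max_left _ _))
    rw [← Finset.sum_product']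
    refine Finset.sum_le_sum_of_subset_of_nonneg (fun p hp => ?_) fun p _ _ => sq_nonneg _
    have := Finset.mem_range.1 (hJ (Finset.mem_image_of_mem _ hp))
    rw [Finset.mem_product, Finset.mem_range, Finset.mem_range]
    omega
  refine ⟨c, ?_⟩
  have h1 : ‖W‖ ^ 2 ≤ K / (1 - ρ) ^ 2 * (4 * Q) := by
    rw [← Real.sq_sqrt hpos]
    gcongr
  have h2 : (0 : ℝ) < 1 - ρ := by linarith
  calc gapConst β n₀ δ s Δ * ‖W‖ ^ 2 ≤ gapConst β n₀ δ s Δ * (K / (1 - ρ) ^ 2 * (4 * Q)) :=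
        mul_le_mul_of_nonneg_left h1 (gapConst_pos hβ hδ hs).le
    _ = Q := by
        rw [gapConst, ← hρdef, ← hKdef]
        field_simp

theorem genOnF_toHS (f : ℝ → ℂ) (x : OpFin) (hx : toHS x ∈ (genOnF f h β).domain) :
    genOnF f h β ⟨toHS x, hx⟩ = toHS (genFin f h β x) := by
  change toHS (genFin f h β ((LinearEquiv.ofInjective toHS toHS_injective).symm ⟨toHS x, hx⟩)) = _
  congr 2
  rw [LinearEquiv.symm_apply_eq]
  exact Subtype.ext rfl

theorem genCore_eq (f : ℝ → ℂ) (hZ : HasGibbsState h β) (X : (genCore f hZ).domain) :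
    ∃ (x : OpFin) (c : ℂ), (X : HilbertSchmidt) = toHS x + c • sqrtGibbs hZ ∧
      genCore f hZ X = toHS (genFin f h β x) := by
  obtain ⟨X, hX⟩ := X
  have hX' := hX
  obtain ⟨_, ⟨x, rfl⟩, _, hy, rfl⟩ := Submodule.mem_sup.1 hX'
  obtain ⟨c, rfl⟩ := Submodule.mem_span_singleton.1 hy
  refine ⟨x, c, rfl, ?_⟩
  have h1 := LinearPMap.supSpanSingleton_apply_mk (genOnF f h β) (sqrtGibbs hZ) 0
    (sqrtGibbs_notMem hZ) (toHS x) ⟨x, rfl⟩ c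
  rw [smul_zero, add_zero] at h1
  exact h1.trans (genOnF_toHS f x _)

theorem dense_range_toHS : Dense (LinearMap.range toHS : Set HilbertSchmidt) := by
  intro y
  refine mem_closure_of_tendsto (lp.hasSum_single (by norm_num) y) (Filter.Eventually.of_forall ?_)
  intro S
  refine Submodule.sum_mem _ fun p _ => ⟨Finsupp.single p (y p), ?_⟩
  rw [toHS, Finsupp.linearCombination_single, ← lp.single_smul]
  simp

/-- The orthogonal projection minimises the distance to `ℂ e`. -/
theorem norm_sq_sub_inner_sq_le {E : Type*} [NormedAddCommGroup E] [InnerProductSpace ℂ E]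
    {e : E} (he : ‖e‖ = 1) (x : E) (c : ℂ) :
    ‖x‖ ^ 2 - ‖inner ℂ e x‖ ^ 2 ≤ ‖x - c • e‖ ^ 2 := by
  have h1 := norm_sub_sq (𝕜 := ℂ) x (c • e)
  rw [inner_smul_right, norm_smul, he, mul_one] at h1
  have h2 : RCLike.re (c * inner ℂ x e) ≤ ‖c‖ * ‖inner ℂ e x‖ := by
    rw [norm_inner_symm, ← norm_mul]
    exact RCLike.re_le_norm _
  nlinarith [sq_nonneg (‖c‖ - ‖inner ℂ e x‖)]

end Core

end

end GibbsSampler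

open GibbsSampler in
theorem mainTheorem6 (β : ℝ) (hβ : 0 < β) (n₀ : ℕ) (δ : ℝ) (hδ : 0 < δ) (s : ℕ) (Δ : ℝ) :
    ∃ κ : ℝ, 0 < κ ∧
      ∀ h : ℕ → ℝ, MonotoneOn h (Set.Ici n₀) →
        (∀ m, n₀ ≤ m → δ ≤ h (m + s) - h m) →
        GibbsSampler.energySpread h n₀ = Δ →
        ∃ hZ : GibbsSampler.HasGibbsState h β,
          (κ : EReal) ≤
              GibbsSampler.gap (GibbsSampler.generator (GibbsSampler.metropolis β) hZ) ∧
            ∀ x : GibbsSampler.HilbertSchmidt,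
              (∃ hx : x ∈ (GibbsSampler.generator (GibbsSampler.metropolis β) hZ).domain,
                  GibbsSampler.generator (GibbsSampler.metropolis β) hZ ⟨x, hx⟩ = 0) ↔
                x ∈ Submodule.span ℂ {GibbsSampler.sqrtGibbs hZ} := by
  -- For `s = 0` the growth condition would force `δ ≤ 0`, so any positive constant serves.
  rcases Nat.eq_zero_or_pos s with rfl | hs
  · refine ⟨1, one_pos, fun h _ hgrow _ => ?_⟩
    have := hgrow n₀ le_rfl
    rw [add_zero, sub_self] at this
    linarith
  refine ⟨gapConst β n₀ δ s Δ, gapConst_pos hβ hδ hs, fun h hmono hgrow hΔ => ?_⟩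
  have hZ : HasGibbsState h β := hasGibbsState hβ hδ hs hmono hgrow
  refine ⟨hZ, ?_⟩
  set T := genCore (metropolis β) hZ with hT
  have hzero : ∀ x, inner ℂ (toHS (genFin (metropolis β) h β x)) (sqrtGibbs hZ) = 0 := fun x => by
    rw [← inner_conj_symm, inner_sqrtGibbs_genFin, map_zero]
  have heD : sqrtGibbs hZ ∈ T.domain :=
    Submodule.mem_sup_right (Submodule.mem_span_singleton_self _)
  have heT : T ⟨sqrtGibbs hZ, heD⟩ = 0 := by
    have h3 := LinearPMap.supSpanSingleton_apply_mk (genOnF (metropolis β) h β) (sqrtGibbs hZ) 0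
      (sqrtGibbs_notMem hZ) 0 (zero_mem _) 1
    rw [smul_zero, add_zero] at h3
    have h4 : (⟨0, zero_mem _⟩ : (genOnF (metropolis β) h β).domain) = 0 := rfl
    rw [h4, LinearPMap.map_zero] at h3
    rw [← h3]
    congr 1
    exact Subtype.ext (by simp)
  refine friedrichs_gap (T := T) (e := sqrtGibbs hZ) ?_ ?_ heD heT (norm_sqrtGibbs hZ)
    (gapConst_pos hβ hδ hs) ?_
  · exact dense_range_toHS.mono (SetLike.coe_subset_coe.2 le_sup_left)
  · intro X Y
    obtain ⟨x, c, hX, hTX⟩ := genCore_eq (metropolis β) hZ X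
    obtain ⟨y, d, hY, hTY⟩ := genCore_eq (metropolis β) hZ Y
    rw [hTX, hTY, hX, hY, inner_add_right, inner_add_left, inner_smul_right, inner_smul_left,
      hzero, inner_sqrtGibbs_genFin, mul_zero, mul_zero, inner_genFin_symm]
  · intro X
    obtain ⟨x, c, hX, hTX⟩ := genCore_eq (metropolis β) hZ X
    obtain ⟨d, hd⟩ := norm_sub_smul_sqrtGibbs_le hβ hδ hs hmono hgrow hΔ hZ x
    have h1 : (quadForm T X).re = -(inner ℂ (toHS (genFin (metropolis β) h β x)) (toHS x)).re := by
      rw [quadForm, hTX, hX, inner_add_right, inner_smul_right, hzero, mul_zero, add_zero,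
        Complex.neg_re]
    rw [h1]
    refine le_trans (mul_le_mul_of_nonneg_left ?_ (gapConst_pos hβ hδ hs).le) hd
    -- The form sees only the finite part `x`; the component `c √σ_β` of `X` is absorbed into the
    -- subtracted multiple.
    refine (norm_sq_sub_inner_sq_le (norm_sqrtGibbs hZ) _ (c + d)).trans (le_of_eq ?_)
    rw [hX, add_smul]
    congr 2
    abel
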